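/- Let $n\ge 1$ and let $X$ be a smooth ($C^\infty$) vector field on an open neighbourhood $U$ of the origin $O$ in $\mathbb R^n$, with $X(O)=0$. Assume: (i) $X$ admits $n-1$ smooth first integrals $F_1,\dots,F_{n-1}$ on $U$, i.e. $X(F_1)=\dots=X(F_{n-1})=0$, with $dF_1\wedge\dots\wedge dF_{n-1}\neq 0$ almost everywhere on $U$; (ii) the semisimple part (in the Jordan–Dunford decomposition) of the linear part of $X$ at $O$ is non-zero, and the $\infty$-jets (Taylor series) $\hat F_1,\dots,\hat F_{n-1}$ of $F_1,\dots,F_{n-1}$ at $O$ are functionally independent, i.e. $d\hat F_1\wedge\dots\wedge d\hat F_{n-1}\ne 0$ as a formal differential form; (iii) if $0$ is an eigenvalue of the linear part of $X$ at $O$ with (algebraic) multiplicity $k\ge 1$, then $dF_1(O)\wedge\dots\wedge dF_k(O)\neq 0$. Then there is a local smooth coordinate system $(x_1,\dots,x_n)$ centred at $O$, defined on an open neighbourhood of $O$ in $U$, in which $$X = F\,X^{(1)} + R,$$ where $X^{(1)}$ is the linear part of $X$ at $O$ in the coordinates $(x_1,\dots,x_n)$, $F$ is a smooth function that is a first integral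 of $X^{(1)}$, i.e. $X^{(1)}(F)=0$, and $R$ is a smooth vector field that is flat at $O$, i.e. all its partial derivatives of all orders (including order $0$) vanish at $O$. -/

import Mathlib

open MeasureTheory
open scoped ContDiff

noncomputable section

namespace SmoothIntegrable

/-- The space `ℝⁿ` with its Euclidean structure; the point `O` is `0`. -/
abbrev E (n : ℕ) : Type := EuclideanSpace ℝ (Fin n)

/-- The partial derivative `∂f/∂xᵢ`. -/
def partialDeriv {n : ℕ} (i : Fin n) (f : E n → ℝ) : E n → ℝ :=
  fun x => fderiv ℝ f x (EuclideanSpace.single i 1)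

/-- The iterated partial derivative `∂^α f = ∂₁^α₁ (∂₂^α₂ ( ⋯ (∂ₙ^αₙ f)))`. -/
def iteratedPartialDeriv {n : ℕ} (α : Fin n →₀ ℕ) (f : E n → ℝ) : E n → ℝ :=
  (List.finRange n).foldr (fun i g => (partialDeriv i)^[α i] g) f

/-- The `∞`-jet of `f` at `O`, i.e. its Taylor series
`∑_α (∂^α f(O) / α!) x^α`, as a formal power series in `n` variables. -/
def jet {n : ℕ} (f : E n → ℝ) : MvPowerSeries (Fin n) ℝ :=
  fun α => iteratedPartialDeriv α f 0 / ((∏ i, (α i).factorial : ℕ) : ℝ)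

/-- Formal series `G₁, …, G_m` are functionally independent if `dG₁ ∧ ⋯ ∧ dG_m ≠ 0`, i.e. their
formal differentials `dGᵢ = (∂Gᵢ/∂x₁, …, ∂Gᵢ/∂xₙ)` are linearly independent over the
integral domain of formal power series. -/
def FormallyIndependent {n m : ℕ} (G : Fin m → MvPowerSeries (Fin n) ℝ) : Prop :=
  LinearIndependent (MvPowerSeries (Fin n) ℝ)
    (fun i : Fin m => fun j : Fin n => MvPowerSeries.pderiv ℝ j (G i))

/-- The linear part at `O` of a vector field `X` vanishing at `O`. -/
def linearPart {n : ℕ} (X : E n → E n) : E n →L[ℝ] E n := fderiv ℝ X 0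

/-- Existence of the Jordan–Dunford decomposition. -/
theorem exists_semisimplePart {n : ℕ} (A : Module.End ℝ (E n)) :
    ∃ S : Module.End ℝ (E n), S.IsSemisimple ∧ IsNilpotent (A - S) ∧ Commute A S := by
  obtain ⟨N, -, S, hSA, hN, hS, h⟩ := Module.End.exists_isNilpotent_isSemisimple (f := A)
  refine ⟨S, hS, ?_, Algebra.commute_of_mem_adjoin_self hSA⟩
  rw [h, add_sub_cancel_right]
  exact hN

/-- The semisimple part `S` of `A` in its Jordan–Dunford decomposition: the unique semisimple
endomorphism commuting with `A` such that `A - S` is nilpotent. -/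
def semisimplePart {n : ℕ} (A : Module.End ℝ (E n)) : Module.End ℝ (E n) :=
  Classical.choose (exists_semisimplePart A)

/-- A map is flat at `O` if its derivatives of all orders (including order `0`) vanish at `O`. -/
def IsFlat {n : ℕ} (R : E n → E n) : Prop :=
  ∀ k : ℕ, iteratedFDeriv ℝ k R 0 = 0

/-- A local smooth coordinate system around `O`, centred at `O`, whose domain `φ.source` is an
open neighbourhood of `O` contained in `U`: a smooth diffeomorphism between open neighbourhoods
of `O`. -/
structure IsSmoothCoordinates {n : ℕ} (U : Set (E n)) (φ : OpenPartialHomeomorph (E n) (E n)) :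
    Prop where
  zero_mem : (0 : E n) ∈ φ.source
  source_subset : φ.source ⊆ U
  map_zero : φ 0 = 0
  smooth : ContDiffOn ℝ ∞ φ φ.source
  smooth_symm : ContDiffOn ℝ ∞ φ.symm φ.target

/-- The expression of the vector field `X` in the coordinates `φ`: the push-forward of `X`,
a vector field on `φ.target`. -/
def inCoordinates {n : ℕ} (φ : OpenPartialHomeomorph (E n) (E n)) (X : E n → E n) : E n → E n :=
  fun y => fderiv ℝ φ (φ.symm y) (X (φ.symm y))

/-- `F` is a first integral of the vector field `X` on the open set `U`: `X(F) = 0`. -/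
def IsFirstIntegral {n : ℕ} (U : Set (E n)) (X : E n → E n) (F : E n → ℝ) : Prop :=
  ∀ x ∈ U, fderiv ℝ F x (X x) = 0

end SmoothIntegrable

end

/-!
A vector field `X` with a zero at `O` acts on Taylor series as a derivation `D` of the ring
`ℝ⟦x₁, …, xₙ⟧` which respects the filtration by order. The proof finds the normal form for `D` and
then realizes it by smooth functions.

*The semisimple part has the same first integrals.* On each finite-dimensional truncation `D` has a
Jordan–Dunford decomposition. These decompositions are functorial, so the semisimple parts fit
together to an operator `S`, and `S` is again a derivation because left multiplication intertwines
`D` with the commutator `[D, ·]` (`exists_semisimple_derivation`). If `D F = 0`, then `S` acts on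
`F` as `-(D - S)`, that is, nilpotently modulo every order; being semisimple, it annihilates `F`
(`semisimple_eq_zero_of_eq_zero`). Moreover, `S` is linear in suitable formal coordinates `y`, since
the obstruction to linearity lies in the range of a semisimple operator
(`exists_linearizing_coordinates`).

*`D` is a multiple of `S`.* Both vector fields are annihilated by the differentials of `n - 1`
functionally independent series, hence they are proportional over the field of fractions. As `S` is
linear, semisimple and non-zero, the ratio is a formal power series `g` (`exists_ratio`). Since `D`
and `S` commute, `S g = 0`, and `g(0) = 1` because `D - S` is nilpotent. Thus `D = g S` is the
required normal form in the formal category, with `S` the linear part of `D` in the coordinates `y`.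

*Realization.* Borel's lemma (`exists_contDiff_jet_eq`) provides smooth coordinates with jets `y`. A
smooth function with jet `g` would be a first integral of the linear part up to flat terms only,
whereas an exact first integral is needed. By Hilbert's finiteness argument the polynomial first
integrals of a semisimple linear vector field are generated by finitely many of them, `p₁, …, pₘ`
(`exists_invariant_generators`). Therefore `g = H(p₁(y), …, pₘ(y))` for a formal power series `H`,
and if `h` is a smooth function with jet `H`, then `h(p₁, …, pₘ)` is an exact first integral with
the right jet. The difference between `X` and its normal form then has zero jet, so that it is flat.
-/

namespace SmoothIntegrable

variable {n : ℕ}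

open Polynomial

/-! ### The Jordan–Dunford decomposition -/

/-- The form in which semisimplicity is used: if `q(T) = 0` with `q` squarefree, then `T = T² r(T)`
for some polynomial `r`, so that kernel and range of `T` are complementary. -/
theorem exists_dvd_X_sub_sq {q : ℝ[X]} (hq : Squarefree q) : ∃ r : ℝ[X], q ∣ X - X ^ 2 * r := by
  by_cases h : X ∣ q
  · obtain ⟨q', rfl⟩ := h
    have hX : ¬ X ∣ q' := fun ⟨c, hc⟩ => by
      have := hq X ⟨c, by rw [hc]; ring⟩
      exact not_isUnit_X this
    have hco : IsCoprime (X : ℝ[X]) q' := (Irreducible.coprime_iff_not_dvd irreducible_X).2 hX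
    obtain ⟨a, b, hab⟩ := hco
    refine ⟨a, b, ?_⟩
    linear_combination -X * hab
  · obtain ⟨a, b, hab⟩ := (Irreducible.coprime_iff_not_dvd irreducible_X).2 h
    refine ⟨a, X * b, ?_⟩
    linear_combination -X * hab

/-- A universal form of the Jordan–Dunford decomposition: for all endomorphisms `T` killed by `χ`,
the same polynomial expression `p(T)` is the semisimple part. -/
theorem exists_jordan_polynomial {χ : ℝ[X]} (hχ : χ ≠ 0) :
    ∃ (p q : ℝ[X]) (M : ℕ), Squarefree q ∧ χ ∣ q.comp p ∧ χ ∣ (X - p) ^ M := by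
  obtain ⟨g, k, sep, -, nil⟩ := exists_squarefree_dvd_pow_of_ne_zero hχ
  have sep' := (PerfectField.separable_iff_squarefree (K := ℝ)).2 sep
  have hx : ∀ f : ℝ[X], aeval (AdjoinRoot.root χ) f = AdjoinRoot.mk χ f := fun f =>
    AdjoinRoot.aeval_eq f
  have h1 : IsNilpotent (aeval (AdjoinRoot.root χ) g) := by
    refine ⟨k, ?_⟩
    rw [hx, ← map_pow, AdjoinRoot.mk_eq_zero]
    exact nil
  have h2 : IsUnit (aeval (AdjoinRoot.root χ) (derivative g)) := by
    obtain ⟨a, b, h⟩ : IsCoprime (g ^ k) (derivative g) := sep'.pow_left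
    have h' := congrArg (AdjoinRoot.mk χ) h
    rw [map_add, map_mul, map_mul, AdjoinRoot.mk_eq_zero.2 nil, mul_zero, zero_add, map_one] at h'
    rw [hx]
    exact IsUnit.of_mul_eq_one_right _ h'
  obtain ⟨s, ⟨⟨M, hM⟩, hs⟩, -⟩ := existsUnique_nilpotent_sub_and_aeval_eq_zero h1 h2
  obtain ⟨p, rfl⟩ := AdjoinRoot.mk_surjective s
  refine ⟨p, g, M, sep, ?_, ?_⟩
  · rw [← AdjoinRoot.mk_eq_zero, ← hs, ← hx, ← hx, aeval_comp]
  · rw [← AdjoinRoot.mk_eq_zero, ← hM, map_pow, map_sub, AdjoinRoot.mk_X]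

theorem aeval_mulLeft {V : Type*} [AddCommGroup V] [Module ℝ V] (S : Module.End ℝ V) (q : ℝ[X]) :
    aeval (LinearMap.mulLeft ℝ S) q = LinearMap.mulLeft ℝ (aeval S q) := by
  have := Polynomial.aeval_algHom_apply (Algebra.lmul ℝ (Module.End ℝ V)) S q
  exact this

theorem aeval_mulRight {V : Type*} [AddCommGroup V] [Module ℝ V] (S : Module.End ℝ V) (q : ℝ[X]) :
    aeval (LinearMap.mulRight ℝ S) q = LinearMap.mulRight ℝ (aeval S q) := by
  rw [aeval_eq_sum_range, aeval_eq_sum_range]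
  ext1 x
  simp only [LinearMap.pow_mulRight, LinearMap.sum_apply, LinearMap.smul_apply,
    LinearMap.mulRight_apply, Finset.mul_sum, mul_smul_comm]

section Jordan

variable {V W : Type*} [AddCommGroup V] [Module ℝ V] [FiniteDimensional ℝ V]
  [AddCommGroup W] [Module ℝ W] [FiniteDimensional ℝ W]

theorem eq_aeval_of_jordan {T S : Module.End ℝ V} (hS : S.IsSemisimple) (hN : IsNilpotent (T - S))
    (hc : Commute T S) {χ p q : ℝ[X]} {M : ℕ} (hχ : aeval T χ = 0) (hq : Squarefree q)
    (hp : χ ∣ q.comp p) (hM : χ ∣ (X - p) ^ M) : S = aeval T p := by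
  have h1 : (aeval T p).IsSemisimple := by
    refine Module.End.isSemisimple_of_squarefree_aeval_eq_zero hq ?_
    obtain ⟨c, hc⟩ := hp
    rw [← aeval_comp, hc, map_mul, hχ, zero_mul]
  have h2 : IsNilpotent (T - aeval T p) := by
    refine ⟨M, ?_⟩
    obtain ⟨c, hc⟩ := hM
    have : T - aeval T p = aeval T (X - p) := by simp
    rw [this, ← map_pow, hc, map_mul, hχ, zero_mul]
  have h3 : Commute T (aeval T p) := by
    have := Polynomial.aeval_X (R := ℝ) T
    rw [commute_iff_eq]
    nth_rewrite 1 [← this]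
    nth_rewrite 4 [← this]
    rw [← map_mul, ← map_mul, mul_comm]
  exact (Module.End.isNilpotent_isSemisimple_unique hN hS h2 h1 (hc.sub_left (Commute.refl S))
    (h3.sub_left (Commute.refl _)) (by simp)).2

/-- Functoriality of the Jordan–Dunford decomposition: a linear map that intertwines two
endomorphisms intertwines their semisimple parts. -/
theorem jordan_intertwine {T S : Module.End ℝ V} (hS : S.IsSemisimple) (hN : IsNilpotent (T - S))
    (hc : Commute T S) {T' S' : Module.End ℝ W} (hS' : S'.IsSemisimple)
    (hN' : IsNilpotent (T' - S')) (hc' : Commute T' S') (f : V →ₗ[ℝ] W)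
    (h : ∀ v, f (T v) = T' (f v)) (v : V) : f (S v) = S' (f v) := by
  have hχ : minpoly ℝ T * minpoly ℝ T' ≠ 0 :=
    mul_ne_zero (minpoly.ne_zero_of_finite ℝ T) (minpoly.ne_zero_of_finite ℝ T')
  obtain ⟨p, q, M, hq, hp, hM⟩ := exists_jordan_polynomial hχ
  rw [eq_aeval_of_jordan hS hN hc (by simp) hq hp hM,
    eq_aeval_of_jordan hS' hN' hc' (by simp) hq hp hM]
  have hpow : ∀ (m : ℕ) (v : V), f ((T ^ m) v) = (T' ^ m) (f v) := by
    intro m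
    induction m with
    | zero => simp
    | succ m ih =>
      intro v
      rw [pow_succ, pow_succ, Module.End.mul_apply, Module.End.mul_apply, ih, h]
  rw [aeval_eq_sum_range, aeval_eq_sum_range]
  simp only [LinearMap.sum_apply, LinearMap.smul_apply, map_sum, map_smul, hpow]

/-- If `S` is the semisimple part of `T`, then `[S, ·]` is the semisimple part of `[T, ·]`. -/
theorem jordan_ad {T S : Module.End ℝ V} (hS : S.IsSemisimple) (hN : IsNilpotent (T - S))
    (hc : Commute T S) :
    Module.End.IsSemisimple (LinearMap.mulLeft ℝ S - LinearMap.mulRight ℝ S) ∧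
    IsNilpotent ((LinearMap.mulLeft ℝ T - LinearMap.mulRight ℝ T) -
      (LinearMap.mulLeft ℝ S - LinearMap.mulRight ℝ S)) ∧
    Commute (LinearMap.mulLeft ℝ T - LinearMap.mulRight ℝ T)
      (LinearMap.mulLeft ℝ S - LinearMap.mulRight ℝ S) := by
  have hLR : ∀ a b : Module.End ℝ V, Commute (LinearMap.mulLeft ℝ a) (LinearMap.mulRight ℝ b) :=
    fun a b => LinearMap.commute_mulLeft_right (R := ℝ) a b
  have hsq := hS.minpoly_squarefree
  refine ⟨?_, ?_, ?_⟩
  · refine Module.End.IsSemisimple.sub_of_commute (hLR S S) ?_ ?_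
    · refine Module.End.isSemisimple_of_squarefree_aeval_eq_zero hsq ?_
      rw [aeval_mulLeft, minpoly.aeval]
      ext1; simp
    · refine Module.End.isSemisimple_of_squarefree_aeval_eq_zero hsq ?_
      rw [aeval_mulRight, minpoly.aeval]
      ext1; simp
  · have : (LinearMap.mulLeft ℝ T - LinearMap.mulRight ℝ T) -
      (LinearMap.mulLeft ℝ S - LinearMap.mulRight ℝ S) =
      LinearMap.mulLeft ℝ (T - S) - LinearMap.mulRight ℝ (T - S) := by
      refine LinearMap.ext fun x => ?_
      simp only [LinearMap.sub_apply, LinearMap.mulLeft_apply, LinearMap.mulRight_apply, sub_mul,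
        mul_sub]
      abel
    rw [this]
    obtain ⟨M, hM⟩ := hN
    refine (hLR _ _).isNilpotent_sub ⟨M, ?_⟩ ⟨M, ?_⟩
    · rw [LinearMap.pow_mulLeft, hM]; ext1; simp
    · rw [LinearMap.pow_mulRight, hM]; ext1; simp
  · have h1 : Commute (LinearMap.mulLeft ℝ T) (LinearMap.mulLeft ℝ S) := by
      refine LinearMap.ext fun x => ?_
      simp [← mul_assoc, hc.eq]
    have h2 : Commute (LinearMap.mulRight ℝ T) (LinearMap.mulRight ℝ S) := by
      refine LinearMap.ext fun x => ?_
      simp [mul_assoc, hc.eq]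
    exact (h1.sub_right (hLR _ _)).sub_left ((hLR _ _).symm.sub_right h2)

end Jordan

/-- The semisimple part of a derivation is a derivation: multiplication `a ↦ L_a` intertwines a
derivation `D` with `[D, ·]`, hence the semisimple part of `D` with that of `[D, ·]`. -/
theorem leibniz_of_jordan {B : Type*} [CommRing B] [Algebra ℝ B] [FiniteDimensional ℝ B]
    {D S : Module.End ℝ B} (hD : ∀ a b, D (a * b) = a * D b + b * D a)
    (hS : S.IsSemisimple) (hN : IsNilpotent (D - S)) (hc : Commute D S) (a b : B) :
    S (a * b) = a * S b + b * S a := by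
  obtain ⟨h1, h2, h3⟩ := jordan_ad hS hN hc
  have := jordan_intertwine hS hN hc h1 h2 h3 (LinearMap.mul ℝ B) (fun v => by
    ext w
    simp [hD, mul_comm w]) a
  have := LinearMap.congr_fun this b
  simp only [LinearMap.mul_apply', LinearMap.sub_apply, LinearMap.mulLeft_apply,
    LinearMap.mulRight_apply, Module.End.mul_apply] at this
  linear_combination -this

section Filtered

variable {V : Type*} [AddCommGroup V] [Module ℝ V]

/-- Endomorphisms of a module whose reductions modulo a finite-codimensional stable submodule are
semisimple and commute have a semisimple difference modulo this submodule. -/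
theorem exists_squarefree_aeval_sub (J : Submodule ℝ V) [FiniteDimensional ℝ (V ⧸ J)]
    {T₁ T₂ : Module.End ℝ V} (h₁ : ∀ v ∈ J, T₁ v ∈ J) (h₂ : ∀ v ∈ J, T₂ v ∈ J)
    (hc : Commute T₁ T₂) {q₁ q₂ : ℝ[X]} (hq₁ : Squarefree q₁) (hq₂ : Squarefree q₂)
    (hT₁ : ∀ v, aeval T₁ q₁ v ∈ J) (hT₂ : ∀ v, aeval T₂ q₂ v ∈ J) :
    ∃ q : ℝ[X], Squarefree q ∧ ∀ v, aeval (T₁ - T₂) q v ∈ J := by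
  have key : ∀ (T : Module.End ℝ V) (hT : ∀ v ∈ J, T v ∈ J) (q : ℝ[X]) (v : V),
      J.mkQ (aeval T q v) = aeval (J.mapQ J T hT) q (J.mkQ v) := by
    intro T hT q v
    have hpow : ∀ (m : ℕ) (v : V), J.mkQ ((T ^ m) v) = ((J.mapQ J T hT) ^ m) (J.mkQ v) := by
      intro m
      induction m with
      | zero => simp
      | succ m ih =>
        intro v
        rw [pow_succ, pow_succ, Module.End.mul_apply, Module.End.mul_apply, ih]
        rfl
    rw [aeval_eq_sum_range, aeval_eq_sum_range]
    simp only [LinearMap.sum_apply, LinearMap.smul_apply, map_sum, map_smul, hpow]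
  have hz : ∀ (T : Module.End ℝ V) (hT : ∀ v ∈ J, T v ∈ J) (q : ℝ[X]),
      (∀ v, aeval T q v ∈ J) → aeval (J.mapQ J T hT) q = 0 := by
    intro T hT q h
    refine LinearMap.ext fun w => ?_
    obtain ⟨v, rfl⟩ := J.mkQ_surjective w
    rw [← key, LinearMap.zero_apply, Submodule.mkQ_apply, Submodule.Quotient.mk_eq_zero]
    exact h v
  have s₁ := Module.End.isSemisimple_of_squarefree_aeval_eq_zero hq₁ (hz T₁ h₁ q₁ hT₁)
  have s₂ := Module.End.isSemisimple_of_squarefree_aeval_eq_zero hq₂ (hz T₂ h₂ q₂ hT₂)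
  have hcQ : Commute (J.mapQ J T₁ h₁) (J.mapQ J T₂ h₂) := by
    refine LinearMap.ext fun w => ?_
    obtain ⟨v, rfl⟩ := J.mkQ_surjective w
    have := LinearMap.congr_fun hc.eq v
    simp only [Module.End.mul_apply] at this
    simp [this]
  have hs := Module.End.IsSemisimple.sub_of_commute hcQ s₁ s₂
  have h₁₂ : ∀ v ∈ J, (T₁ - T₂) v ∈ J := fun v hv => J.sub_mem (h₁ v hv) (h₂ v hv)
  have he : J.mapQ J T₁ h₁ - J.mapQ J T₂ h₂ = J.mapQ J (T₁ - T₂) h₁₂ := by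
    refine LinearMap.ext fun w => ?_
    obtain ⟨v, rfl⟩ := J.mkQ_surjective w
    simp
  rw [he] at hs
  refine ⟨_, hs.minpoly_squarefree, fun v => ?_⟩
  rw [← Submodule.Quotient.mk_eq_zero, ← Submodule.mkQ_apply, key (T₁ - T₂) h₁₂, minpoly.aeval,
    LinearMap.zero_apply]

end Filtered

/-! ### The order filtration on formal power series -/

/-- Formal power series with real coefficients in `n` variables. -/
abbrev PS (n : ℕ) : Type := MvPowerSeries (Fin n) ℝ

/-- The ideal of formal power series of order at least `k`, i.e. the `k`-th power of the maximal
ideal. -/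
def ordIdeal (n k : ℕ) : Ideal (PS n) where
  carrier := {a | ∀ α : Fin n →₀ ℕ, α.degree < k → MvPowerSeries.coeff α a = 0}
  zero_mem' := fun α _ => map_zero _
  add_mem' := fun {a b} ha hb α hα => by rw [map_add, ha α hα, hb α hα, add_zero]
  smul_mem' := fun c a ha α hα => by
    classical
    rw [smul_eq_mul, MvPowerSeries.coeff_mul]
    refine Finset.sum_eq_zero fun p hp => ?_
    rw [ha p.2, mul_zero]
    rw [Finset.HasAntidiagonal.mem_antidiagonal] at hp
    have := congrArg Finsupp.degree hp
    rw [map_add] at this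
    omega

theorem ordIdeal_anti {j k : ℕ} (h : j ≤ k) : ordIdeal n k ≤ ordIdeal n j :=
  fun _ ha α hα => ha α (hα.trans_le h)

theorem mem_ordIdeal_zero (a : PS n) : a ∈ ordIdeal n 0 := fun _ hα => absurd hα (by omega)

theorem smul_mem_ordIdeal {k : ℕ} (c : ℝ) {a : PS n} (ha : a ∈ ordIdeal n k) :
    c • a ∈ ordIdeal n k := by
  rw [Algebra.smul_def]
  exact Ideal.mul_mem_left _ _ ha

theorem mul_mem_ordIdeal {j k : ℕ} {a b : PS n} (ha : a ∈ ordIdeal n j) (hb : b ∈ ordIdeal n k) :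
    a * b ∈ ordIdeal n (j + k) := by
  classical
  intro α hα
  rw [MvPowerSeries.coeff_mul]
  refine Finset.sum_eq_zero fun p hp => ?_
  rw [Finset.HasAntidiagonal.mem_antidiagonal] at hp
  have := congrArg Finsupp.degree hp
  rw [map_add] at this
  by_cases h : p.1.degree < j
  · rw [ha _ h, zero_mul]
  · rw [hb _ (by omega), mul_zero]

theorem eq_zero_of_forall_mem_ordIdeal {a : PS n} (h : ∀ k, a ∈ ordIdeal n k) : a = 0 := by
  ext α
  exact h (α.degree + 1) α (by omega)

theorem mem_ordIdeal_one {a : PS n} :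
    a ∈ ordIdeal n 1 ↔ MvPowerSeries.constantCoeff a = 0 := by
  constructor
  · intro h
    rw [← MvPowerSeries.coeff_zero_eq_constantCoeff_apply]
    exact h 0 (by simp)
  · intro h α hα
    have : α = 0 := by
      rw [← Finsupp.degree_eq_zero_iff]; omega
    rw [this, MvPowerSeries.coeff_zero_eq_constantCoeff_apply, h]

theorem X_mem_ordIdeal (i : Fin n) : (MvPowerSeries.X i : PS n) ∈ ordIdeal n 1 :=
  mem_ordIdeal_one.2 (MvPowerSeries.constantCoeff_X i)

theorem pderiv_mem_ordIdeal {k : ℕ} (i : Fin n) {a : PS n} (ha : a ∈ ordIdeal n (k + 1)) :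
    MvPowerSeries.pderiv ℝ i a ∈ ordIdeal n k := by
  intro α hα
  rw [MvPowerSeries.coeff_pderiv, ha, zero_mul]
  rw [map_add, Finsupp.degree_single]
  omega

theorem mem_ordIdeal_succ {k : ℕ} {a : PS n} : a ∈ ordIdeal n (k + 1) ↔
    MvPowerSeries.constantCoeff a = 0 ∧ ∀ i, MvPowerSeries.pderiv ℝ i a ∈ ordIdeal n k := by
  refine ⟨fun h => ⟨mem_ordIdeal_one.1 (ordIdeal_anti (by omega) h),
    fun i => pderiv_mem_ordIdeal i h⟩, fun ⟨h0, h⟩ α hα => ?_⟩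
  by_cases hz : α = 0
  · rw [hz, MvPowerSeries.coeff_zero_eq_constantCoeff_apply, h0]
  · obtain ⟨i, hi⟩ := Finsupp.ne_iff.1 hz
    have hle : Finsupp.single i 1 ≤ α := by
      rw [Finsupp.single_le_iff]
      exact Nat.one_le_iff_ne_zero.2 hi
    have hdeg : (α - Finsupp.single i 1).degree < k := by
      have := congrArg Finsupp.degree (tsub_add_cancel_of_le hle)
      rw [map_add, Finsupp.degree_single] at this
      omega
    have := h i _ hdeg
    rw [MvPowerSeries.coeff_pderiv, tsub_add_cancel_of_le hle] at this
    refine (mul_eq_zero.1 this).resolve_right ?_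
    positivity

/-! ### Finite-dimensional truncations and completeness -/

theorem finiteDimensional_quotient {V W : Type*} [AddCommGroup V] [Module ℝ V] [AddCommGroup W]
    [Module ℝ W] [FiniteDimensional ℝ W] (f : V →ₗ[ℝ] W) (J : Submodule ℝ V)
    (h : ∀ v, f v = 0 → v ∈ J) : FiniteDimensional ℝ (V ⧸ J) := by
  have h1 : FiniteDimensional ℝ (V ⧸ LinearMap.ker f) :=
    (f.quotKerEquivRange).symm.finiteDimensional
  exact Module.Finite.of_surjective (Submodule.factor (p := LinearMap.ker f) (p' := J) h)
    (Submodule.factor_surjective h)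

/-- Families of formal power series all of whose members have order at least `k`. -/
def ordSub (ι : Type*) (n k : ℕ) : Submodule ℝ (ι → PS n) where
  carrier := {v | ∀ i, v i ∈ ordIdeal n k}
  zero_mem' := fun _ => zero_mem _
  add_mem' := fun ha hb i => add_mem (ha i) (hb i)
  smul_mem' := fun c _ ha i => smul_mem_ordIdeal c (ha i)

instance finiteDimensional_quotient_ordSub (ι : Type*) [Finite ι] (k : ℕ) :
    FiniteDimensional ℝ ((ι → PS n) ⧸ ordSub ι n k) := by
  have : Finite {α : Fin n →₀ ℕ // α.degree < k} := Finsupp.finite_of_degree_lt k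
  refine finiteDimensional_quotient (W := ι → {α : Fin n →₀ ℕ // α.degree < k} → ℝ)
    (LinearMap.pi fun i => LinearMap.pi fun α =>
      MvPowerSeries.coeff α.1 ∘ₗ LinearMap.proj i) _ fun v hv i α hα => ?_
  exact congrFun (congrFun hv i) ⟨α, hα⟩

instance finiteDimensional_quotient_ordIdeal (k : ℕ) :
    FiniteDimensional ℝ (PS n ⧸ ordIdeal n k) := by
  have : Finite {α : Fin n →₀ ℕ // α.degree < k} := Finsupp.finite_of_degree_lt k
  exact finiteDimensional_quotient (W := {α : Fin n →₀ ℕ // α.degree < k} → ℝ)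
    (LinearMap.pi fun α => MvPowerSeries.coeff α.1) ((ordIdeal n k).restrictScalars ℝ)
    fun v hv α hα => congrFun hv ⟨α, hα⟩

/-- A series of formal power series whose orders tend to infinity converges. -/
theorem exists_sum_ordIdeal (k : ℕ) (v : ℕ → PS n) (h : ∀ j, v j ∈ ordIdeal n (k + j)) :
    ∃ s : PS n, ∀ K, s - ∑ j ∈ Finset.range K, v j ∈ ordIdeal n (k + K) := by
  let s : PS n := fun α => ∑ j ∈ Finset.range (α.degree + 1), MvPowerSeries.coeff α (v j)
  have hs : ∀ α, MvPowerSeries.coeff α s =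
      ∑ j ∈ Finset.range (α.degree + 1), MvPowerSeries.coeff α (v j) := fun _ => rfl
  refine ⟨s, fun K α hα => ?_⟩
  rw [map_sub, map_sum, sub_eq_zero, hs]
  have aux : ∀ N M, α.degree < k + N → N ≤ M → ∑ j ∈ Finset.range M,
      MvPowerSeries.coeff α (v j) = ∑ j ∈ Finset.range N, MvPowerSeries.coeff α (v j) := by
    intro N M hN hNM
    symm
    refine Finset.sum_subset (fun j hj => ?_) fun j _ hj => ?_
    · rw [Finset.mem_range] at hj ⊢; omega
    · rw [Finset.mem_range] at hj
      exact h j α (by omega)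
  rw [← aux (α.degree + 1) (α.degree + 1 + K) (by omega) (by omega),
    ← aux K (α.degree + 1 + K) hα (by omega)]

/-- Successive approximation: if a filtered linear map `T` from a space of families of formal
power series solves `T v = w`, `w ∈ C`, up to an error in `C` of higher order, then it solves the
equation exactly. The filtration of the target is `Wf`, and `C` is a space of compatibility
conditions. -/
theorem successive_approximation {ι W : Type*} [AddCommGroup W] [Module ℝ W]
    (T : (ι → PS n) →ₗ[ℝ] W) (Wf : ℕ → Submodule ℝ W)
    (hsep : ∀ w, (∀ k, w ∈ Wf k) → w = 0) (hanti : ∀ k l, k ≤ l → Wf l ≤ Wf k)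
    (hT : ∀ k, ∀ v ∈ ordSub ι n k, T v ∈ Wf k) (C : Submodule ℝ W)
    (step : ∀ k, ∀ w ∈ C, w ∈ Wf k →
      ∃ v ∈ ordSub ι n k, w - T v ∈ C ∧ w - T v ∈ Wf (k + 1))
    (k : ℕ) (w : W) (hwC : w ∈ C) (hw : w ∈ Wf k) : ∃ v ∈ ordSub ι n k, T v = w := by
  choose! g hg hgC hgW using step
  let s : ℕ → W := fun j => Nat.rec w (fun j u => u - T (g (k + j) u)) j
  have hs0 : s 0 = w := rfl
  have hs : ∀ j, s (j + 1) = s j - T (g (k + j) (s j)) := fun j => rfl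
  have hsm : ∀ j, s j ∈ C ∧ s j ∈ Wf (k + j) := by
    intro j
    induction j with
    | zero => exact ⟨hwC, hw⟩
    | succ j ih =>
      rw [hs]
      exact ⟨hgC _ _ ih.1 ih.2, hgW _ _ ih.1 ih.2⟩
  have hvm : ∀ j, g (k + j) (s j) ∈ ordSub ι n (k + j) := fun j => hg _ _ (hsm j).1 (hsm j).2
  have hlim : ∀ i, ∃ a : PS n, ∀ K,
      a - ∑ j ∈ Finset.range K, g (k + j) (s j) i ∈ ordIdeal n (k + K) := fun i =>
    exists_sum_ordIdeal k (fun j => g (k + j) (s j) i) fun j => hvm j i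
  choose a ha using hlim
  have hsum : ∀ K, s K = w - T (∑ j ∈ Finset.range K, g (k + j) (s j)) := by
    intro K
    induction K with
    | zero => simp [hs0]
    | succ K ih => rw [hs, Finset.sum_range_succ, map_add, ← sub_sub, ← ih]
  refine ⟨a, fun i => by simpa using ha i 0, ?_⟩
  refine (sub_eq_zero.1 (hsep _ fun K => hanti K (k + K) (by omega) ?_)).symm
  have h1 : a - ∑ j ∈ Finset.range K, g (k + j) (s j) ∈ ordSub ι n (k + K) := by
    intro i
    simpa using ha i K
  have h2 : w - T a = s K - T (a - ∑ j ∈ Finset.range K, g (k + j) (s j)) := by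
    rw [hsum K, map_sub]; abel
  rw [h2]
  exact sub_mem (hsm K).2 (hT _ _ h1)

/-! ### Polynomials and derivations -/

theorem sub_truncTotal_mem (k : ℕ) (a : PS n) :
    a - (MvPowerSeries.truncTotal k a : PS n) ∈ ordIdeal n k := by
  intro α hα
  rw [map_sub, MvPolynomial.coeff_coe, MvPowerSeries.coeff_truncTotal a hα, sub_self]

theorem isHomogeneous_truncTotal {d : ℕ} {a : PS n} (ha : a ∈ ordIdeal n d) :
    (MvPowerSeries.truncTotal (d + 1) a).IsHomogeneous d := by
  intro α hα
  rw [MvPowerSeries.coeff_truncTotal_eq_ite] at hα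
  have h1 : α.degree < d + 1 := by
    by_contra h
    exact hα (if_neg h)
  have h2 : ¬ α.degree < d := fun h => hα (by rw [if_pos h1, ha α h])
  change Finsupp.weight (fun _ => 1) α = d
  rw [← Finsupp.degree_eq_weight_one]
  omega

theorem coe_mem_ordIdeal {d : ℕ} {P : MvPolynomial (Fin n) ℝ} (hP : P.IsHomogeneous d) :
    (P : PS n) ∈ ordIdeal n d := by
  intro α hα
  rw [MvPolynomial.coeff_coe]
  exact hP.coeff_eq_zero (by omega)

theorem eq_zero_of_coe_mem_ordIdeal {d : ℕ} {P : MvPolynomial (Fin n) ℝ} (hP : P.IsHomogeneous d)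
    (h : (P : PS n) ∈ ordIdeal n (d + 1)) : P = 0 := by
  ext α
  rw [MvPolynomial.coeff_zero]
  by_cases hα : α.degree = d
  · rw [← MvPolynomial.coeff_coe]
    exact h α (by omega)
  · exact hP.coeff_eq_zero hα

/-- The chain rule for a derivation evaluated at a polynomial expression. -/
theorem derivation_aeval {B : Type*} [CommRing B] [Algebra ℝ B] (S : Derivation ℝ B B)
    (y : Fin n → B) (P : MvPolynomial (Fin n) ℝ) :
    S (MvPolynomial.aeval y P) =
      ∑ j, MvPolynomial.aeval y (MvPolynomial.pderiv j P) * S (y j) := by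
  classical
  induction P using MvPolynomial.induction_on with
  | C a => simp
  | add p q hp hq => simp only [map_add, hp, hq, add_mul, Finset.sum_add_distrib]
  | mul_X p i hp =>
    simp only [map_mul, MvPolynomial.aeval_X, Derivation.leibniz, hp, smul_eq_mul, map_add,
      MvPolynomial.pderiv_X, add_mul, Finset.sum_add_distrib, Finset.mul_sum]
    congr 1
    · rw [Finset.sum_eq_single i]
      · simp
      · intro j _ hj; simp [hj.symm]
      · simp
    · exact Finset.sum_congr rfl fun j _ => by ring

theorem aeval_X_eq_coe (P : MvPolynomial (Fin n) ℝ) :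
    MvPolynomial.aeval (fun i => (MvPowerSeries.X i : PS n)) P = (P : PS n) := by
  have : MvPolynomial.aeval (fun i => (MvPowerSeries.X i : PS n)) =
      (MvPolynomial.coeToMvPowerSeries.algHom ℝ : MvPolynomial (Fin n) ℝ →ₐ[ℝ] PS n) := by
    refine MvPolynomial.algHom_ext fun i => ?_
    simp
  rw [this]
  simp

/-- A derivation of the ring of formal power series that does not lower orders is the vector field
`∑ S(xⱼ) ∂ⱼ`. -/
theorem derivation_eq_sum_pderiv (S : Derivation ℝ (PS n) (PS n))
    (hS : ∀ k, ∀ a ∈ ordIdeal n k, S a ∈ ordIdeal n k) (a : PS n) :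
    S a = ∑ j, MvPowerSeries.pderiv ℝ j a * S (MvPowerSeries.X j) := by
  rw [← sub_eq_zero]
  refine eq_zero_of_forall_mem_ordIdeal fun k => ?_
  set P := MvPowerSeries.truncTotal (k + 1) a
  have hP : S (P : PS n) -
      ∑ j, MvPowerSeries.pderiv ℝ j (P : PS n) * S (MvPowerSeries.X j) = 0 := by
    rw [← aeval_X_eq_coe, derivation_aeval, aeval_X_eq_coe, sub_eq_zero]
    simp only [aeval_X_eq_coe, MvPowerSeries.pderiv_coe]
  have h1 := sub_truncTotal_mem (k + 1) a
  have h2 : S a - ∑ j, MvPowerSeries.pderiv ℝ j a * S (MvPowerSeries.X j) =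
      S (a - P) - ∑ j, MvPowerSeries.pderiv ℝ j (a - (P : PS n)) * S (MvPowerSeries.X j) := by
    rw [← sub_zero (S a - _), ← hP]
    simp only [map_sub, sub_mul, Finset.sum_sub_distrib]
    abel
  rw [h2]
  exact sub_mem (hS k _ (ordIdeal_anti (by omega) h1))
    (Submodule.sum_mem _ fun j _ => Ideal.mul_mem_right _ _ (pderiv_mem_ordIdeal j h1))

/-! ### The semisimple part of a formal vector field -/

theorem exists_quotient_end {k : ℕ} (D : Module.End ℝ (PS n))
    (hD : ∀ a ∈ ordIdeal n k, D a ∈ ordIdeal n k) :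
    ∃ Dk : Module.End ℝ (PS n ⧸ ordIdeal n k),
      ∀ a, Dk (Ideal.Quotient.mk _ a) = Ideal.Quotient.mk _ (D a) := by
  have hout : ∀ b : PS n ⧸ ordIdeal n k, Ideal.Quotient.mk _ (Quotient.out b) = b :=
    fun b => Quotient.out_eq b
  have hwd : ∀ a b : PS n, Ideal.Quotient.mk (ordIdeal n k) a = Ideal.Quotient.mk _ b →
      Ideal.Quotient.mk (ordIdeal n k) (D a) = Ideal.Quotient.mk _ (D b) := by
    intro a b h
    rw [Ideal.Quotient.eq] at h ⊢
    rw [← map_sub]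
    exact hD _ h
  have hsm : ∀ (c : ℝ) (a : PS n), Ideal.Quotient.mk (ordIdeal n k) (c • a) =
      c • Ideal.Quotient.mk (ordIdeal n k) a := fun c a => map_smul (Ideal.Quotient.mkₐ ℝ _) c a
  refine ⟨{ toFun := fun b => Ideal.Quotient.mk _ (D (Quotient.out b))
            map_add' := fun b c => ?_
            map_smul' := fun c b => ?_ }, fun a => hwd _ _ (hout _)⟩
  · rw [← map_add, ← map_add]
    exact hwd _ _ (by rw [hout, map_add, hout, hout])
  · rw [RingHom.id_apply, ← hsm, ← map_smul]
    exact hwd _ _ (by rw [hout, hsm, hout])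

/-- **Jordan–Dunford decomposition of a formal vector field.** A derivation `D` of the ring of
formal power series that respects the order filtration has a semisimple part `S`: a derivation
that commutes with `D` and, modulo any given order, is semisimple with `D - S` nilpotent. It is the
limit of the semisimple parts of the endomorphisms induced by `D` on the finite-dimensional
truncations, which are compatible by functoriality. -/
theorem exists_semisimple_derivation (D : Derivation ℝ (PS n) (PS n))
    (hD : ∀ k, ∀ a ∈ ordIdeal n k, D a ∈ ordIdeal n k) :
    ∃ S : Derivation ℝ (PS n) (PS n), (∀ k, ∀ a ∈ ordIdeal n k, S a ∈ ordIdeal n k) ∧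
      Commute (D : Module.End ℝ (PS n)) (S : Module.End ℝ (PS n)) ∧
      (∀ k, ∃ q : ℝ[X], Squarefree q ∧
        ∀ a, aeval (S : Module.End ℝ (PS n)) q a ∈ ordIdeal n k) ∧
      ∀ k, ∃ M : ℕ, ∀ a,
        (((D : Module.End ℝ (PS n)) - (S : Module.End ℝ (PS n))) ^ M) a ∈ ordIdeal n k := by
  have hDk := fun k => exists_quotient_end (D : Module.End ℝ (PS n)) (hD k)
  choose Dk hDk using hDk
  have hJ : ∀ k, ∃ S : Module.End ℝ (PS n ⧸ ordIdeal n k), S.IsSemisimple ∧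
      IsNilpotent (Dk k - S) ∧ Commute (Dk k) S := by
    intro k
    obtain ⟨N, -, S, hSA, hN, hS, h⟩ := Module.End.exists_isNilpotent_isSemisimple (f := Dk k)
    refine ⟨S, hS, ?_, Algebra.commute_of_mem_adjoin_self hSA⟩
    rw [h, add_sub_cancel_right]
    exact hN
  choose Sk hss hnil hcom using hJ
  have hmk : ∀ k, Function.Surjective (Ideal.Quotient.mk (ordIdeal n k)) := fun k =>
    Ideal.Quotient.mk_surjective
  have hleib : ∀ k (a b : PS n ⧸ ordIdeal n k), Sk k (a * b) = a * Sk k b + b * Sk k a := by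
    intro k
    refine leibniz_of_jordan (fun a b => ?_) (hss k) (hnil k) (hcom k)
    obtain ⟨a, rfl⟩ := hmk k a
    obtain ⟨b, rfl⟩ := hmk k b
    rw [← map_mul, hDk, hDk, hDk, ← map_mul, ← map_mul, ← map_add]
    simp
  have hcompat : ∀ j k (h : j ≤ k) (b : PS n ⧸ ordIdeal n k),
      Ideal.Quotient.factor (ordIdeal_anti h) (Sk k b) =
        Sk j (Ideal.Quotient.factor (ordIdeal_anti h) b) := by
    intro j k h b
    refine jordan_intertwine (hss k) (hnil k) (hcom k) (hss j) (hnil j) (hcom j)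
      (Ideal.Quotient.factorₐ ℝ (ordIdeal_anti h)).toLinearMap (fun v => ?_) b
    obtain ⟨a, rfl⟩ := hmk k v
    rw [hDk]
    exact (hDk j a).symm
  have hrep : ∀ k (a : PS n), ∃ b : PS n,
      Ideal.Quotient.mk (ordIdeal n k) b = Sk k (Ideal.Quotient.mk _ a) := fun k a => hmk k _
  choose s hs using hrep
  -- the coefficient of `S a` at `α` is read off modulo order `|α| + 1`
  let S₀ : PS n → PS n := fun a α => MvPowerSeries.coeff α (s (α.degree + 1) a)
  have hS₀c : ∀ a α, MvPowerSeries.coeff α (S₀ a) =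
      MvPowerSeries.coeff α (s (α.degree + 1) a) := fun _ _ => rfl
  have hS₀ : ∀ k a, Ideal.Quotient.mk (ordIdeal n k) (S₀ a) = Sk k (Ideal.Quotient.mk _ a) := by
    intro k a
    rw [← hs, Ideal.Quotient.eq]
    intro α hα
    have h1 := hcompat (α.degree + 1) k hα (Ideal.Quotient.mk _ a)
    rw [← hs, Ideal.Quotient.factor_mk, Ideal.Quotient.factor_mk, ← hs, Ideal.Quotient.eq] at h1
    have h2 := h1 α (by omega)
    rw [map_sub, sub_eq_zero] at h2
    rw [map_sub, hS₀c, h2, sub_self]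
  have hsep : ∀ a b : PS n, (∀ k, Ideal.Quotient.mk (ordIdeal n k) a =
      Ideal.Quotient.mk (ordIdeal n k) b) → a = b := by
    intro a b h
    rw [← sub_eq_zero]
    exact eq_zero_of_forall_mem_ordIdeal fun k => by rw [← Ideal.Quotient.eq, h]
  have hsm : ∀ k (c : ℝ) (a : PS n), Ideal.Quotient.mk (ordIdeal n k) (c • a) =
      c • Ideal.Quotient.mk (ordIdeal n k) a := fun k c a => map_smul (Ideal.Quotient.mkₐ ℝ _) c a
  let S₁ : PS n →ₗ[ℝ] PS n :=
    { toFun := S₀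
      map_add' := fun a b => hsep _ _ fun k => by simp only [hS₀, map_add]
      map_smul' := fun c a => hsep _ _ fun k => by
        rw [RingHom.id_apply, hS₀, hsm, hsm, hS₀, map_smul] }
  let S : Derivation ℝ (PS n) (PS n) := Derivation.mk' S₁ fun a b => hsep _ _ fun k => by
    change Ideal.Quotient.mk _ (S₀ (a * b)) = Ideal.Quotient.mk _ (a * S₀ b + b * S₀ a)
    simp only [hS₀, map_add, map_mul, hleib]
  have hSa : ∀ k (a : PS n), Ideal.Quotient.mk (ordIdeal n k) (S a) =
      Sk k (Ideal.Quotient.mk _ a) := hS₀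
  refine ⟨S, fun k a ha => ?_, ?_, fun k => ?_, fun k => ?_⟩
  · rw [← Ideal.Quotient.eq_zero_iff_mem] at ha ⊢
    rw [hSa, ha, map_zero]
  · refine LinearMap.ext fun a => hsep _ _ fun k => ?_
    have := LinearMap.congr_fun (hcom k).eq (Ideal.Quotient.mk _ a)
    simp only [Module.End.mul_apply, Derivation.coeFn_coe] at this ⊢
    have h1 : Dk k (Ideal.Quotient.mk _ (S a)) = Ideal.Quotient.mk _ (D (S a)) := hDk k (S a)
    have h2 : Dk k (Ideal.Quotient.mk _ a) = Ideal.Quotient.mk _ (D a) := hDk k a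
    rw [hSa, ← h2, ← h1, hSa, this]
  · refine ⟨_, (hss k).minpoly_squarefree, fun a => ?_⟩
    have hpow : ∀ (m : ℕ) (a : PS n), Ideal.Quotient.mk (ordIdeal n k)
        (((S : Module.End ℝ (PS n)) ^ m) a) = (Sk k ^ m) (Ideal.Quotient.mk _ a) := by
      intro m
      induction m with
      | zero => simp
      | succ m ih =>
        intro a
        rw [pow_succ, pow_succ, Module.End.mul_apply, Module.End.mul_apply, ih,
          Derivation.coeFn_coe, hSa]
    have hq : ∀ q : ℝ[X], Ideal.Quotient.mk (ordIdeal n k)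
        (aeval (S : Module.End ℝ (PS n)) q a) = aeval (Sk k) q (Ideal.Quotient.mk _ a) := by
      intro q
      rw [aeval_eq_sum_range, aeval_eq_sum_range]
      simp only [LinearMap.sum_apply, LinearMap.smul_apply, map_sum, hsm, hpow]
    rw [← Ideal.Quotient.eq_zero_iff_mem, hq, minpoly.aeval, LinearMap.zero_apply]
  · obtain ⟨M, hM⟩ := hnil k
    refine ⟨M, fun a => ?_⟩
    have hpow : ∀ (m : ℕ) (a : PS n), Ideal.Quotient.mk (ordIdeal n k)
        ((((D : Module.End ℝ (PS n)) - (S : Module.End ℝ (PS n))) ^ m) a) =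
        ((Dk k - Sk k) ^ m) (Ideal.Quotient.mk _ a) := by
      intro m
      induction m with
      | zero => simp
      | succ m ih =>
        intro a
        rw [pow_succ, pow_succ, Module.End.mul_apply, Module.End.mul_apply, ih,
          LinearMap.sub_apply, map_sub, Derivation.coeFn_coe S, hSa, ← hDk, LinearMap.sub_apply]
    rw [← Ideal.Quotient.eq_zero_iff_mem, hpow, hM, LinearMap.zero_apply]

/-- Modulo any given order, an endomorphism annihilated by a squarefree polynomial satisfies
`S = S² r(S)`. -/
theorem exists_sub_sq_mem {V : Type*} [AddCommGroup V] [Module ℝ V] {T : Module.End ℝ V}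
    {J : Submodule ℝ V} {q : ℝ[X]} (hq : Squarefree q)
    (hT : ∀ v, aeval T q v ∈ J) :
    ∃ r : ℝ[X], ∀ v, T v - T (T (aeval T r v)) ∈ J := by
  obtain ⟨r, c, hr⟩ := exists_dvd_X_sub_sq hq
  refine ⟨r, fun v => ?_⟩
  have h := congrArg (fun p => aeval T p v) hr
  simp only [map_sub, map_mul, aeval_X, LinearMap.sub_apply, pow_two,
    Module.End.mul_apply] at h
  rw [h]
  exact hT _

theorem aeval_mem {V : Type*} [AddCommGroup V] [Module ℝ V] {T : Module.End ℝ V}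
    {J : Submodule ℝ V} (hJ : ∀ v ∈ J, T v ∈ J) (q : ℝ[X]) {v : V} (hv : v ∈ J) :
    aeval T q v ∈ J := by
  have hpow : ∀ m : ℕ, (T ^ m) v ∈ J := by
    intro m
    induction m with
    | zero => simpa
    | succ m ih => rw [pow_succ', Module.End.mul_apply]; exact hJ _ ih
  rw [aeval_eq_sum_range, LinearMap.sum_apply]
  exact J.sum_mem fun i _ => J.smul_mem _ (hpow i)

/-- If `D` and its semisimple part `S` commute and `D - S` is nilpotent modulo every order, then
every formal first integral of `D` is a first integral of `S`. -/
theorem semisimple_eq_zero_of_eq_zero {D S : Derivation ℝ (PS n) (PS n)}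
    (hS : ∀ k, ∀ a ∈ ordIdeal n k, S a ∈ ordIdeal n k)
    (hc : Commute (D : Module.End ℝ (PS n)) (S : Module.End ℝ (PS n)))
    (hss : ∀ k, ∃ q : ℝ[X], Squarefree q ∧
        ∀ a, aeval (S : Module.End ℝ (PS n)) q a ∈ ordIdeal n k)
    (hnil : ∀ k, ∃ M : ℕ, ∀ a,
        (((D : Module.End ℝ (PS n)) - (S : Module.End ℝ (PS n))) ^ M) a ∈ ordIdeal n k)
    {a : PS n} (ha : D a = 0) : S a = 0 := by
  refine eq_zero_of_forall_mem_ordIdeal fun k => ?_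
  obtain ⟨q, hq, hqS⟩ := hss k
  obtain ⟨M, hM⟩ := hnil k
  obtain ⟨r, hr⟩ := exists_sub_sq_mem (T := (S : Module.End ℝ (PS n)))
    (J := (ordIdeal n k).restrictScalars ℝ) hq hqS
  -- on the kernel of `D`, powers of `D - S` are powers of `-S`
  have hpow : ∀ m : ℕ, (((D : Module.End ℝ (PS n)) - (S : Module.End ℝ (PS n))) ^ m) a =
      ((-1 : ℝ) ^ m) • ((S : Module.End ℝ (PS n)) ^ m) a := by
    intro m
    have hDS : ∀ m : ℕ, D (((S : Module.End ℝ (PS n)) ^ m) a) = 0 := by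
      intro m
      have := LinearMap.congr_fun (hc.pow_right m).eq a
      simp only [Module.End.mul_apply, Derivation.coeFn_coe, ha, map_zero] at this
      exact this
    induction m with
    | zero => simp
    | succ m ih =>
      rw [pow_succ', Module.End.mul_apply, ih, map_smul, LinearMap.sub_apply,
        Derivation.coeFn_coe D, hDS, zero_sub, pow_succ' (S : Module.End ℝ (PS n)),
        Module.End.mul_apply, pow_succ', mul_smul, smul_neg, neg_one_smul]
  have hSM : ((S : Module.End ℝ (PS n)) ^ M) a ∈ ordIdeal n k := by
    have := smul_mem_ordIdeal ((-1 : ℝ) ^ M) (hM a)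
    rw [hpow, smul_smul, ← mul_pow] at this
    simpa using this
  -- descending induction on the exponent
  have hdesc : ∀ m : ℕ, ((S : Module.End ℝ (PS n)) ^ (m + 1)) a ∈ ordIdeal n k →
      S a ∈ ordIdeal n k := by
    intro m
    induction m with
    | zero => simp
    | succ m ih =>
      intro h
      refine ih ?_
      have h1 := hr (((S : Module.End ℝ (PS n)) ^ m) a)
      have h2 : (S : Module.End ℝ (PS n)) ((S : Module.End ℝ (PS n))
          (aeval (S : Module.End ℝ (PS n)) r (((S : Module.End ℝ (PS n)) ^ m) a))) =
          aeval (S : Module.End ℝ (PS n)) r (((S : Module.End ℝ (PS n)) ^ (m + 2)) a) := by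
        have e := congrArg (fun p => aeval (S : Module.End ℝ (PS n)) p a)
          (show (X * (X * (r * X ^ m)) : ℝ[X]) = r * X ^ (m + 2) by ring)
        simpa only [map_mul, map_pow, aeval_X, Module.End.mul_apply] using e
      rw [h2] at h1
      have h3 : aeval (S : Module.End ℝ (PS n)) r (((S : Module.End ℝ (PS n)) ^ (m + 2)) a) ∈
          (ordIdeal n k).restrictScalars ℝ := aeval_mem (hS k) r h
      have := add_mem h1 h3
      rw [sub_add_cancel] at this
      rwa [pow_succ', Module.End.mul_apply]
  refine hdesc M ?_
  rw [pow_succ', Module.End.mul_apply]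
  exact hS k _ hSM

/-! ### Linearization of a semisimple formal vector field -/

/-- The matrix of linear coefficients of the formal vector field `S`. -/
noncomputable def linCoeff (S : Derivation ℝ (PS n) (PS n)) : Matrix (Fin n) (Fin n) ℝ :=
  fun i j => MvPowerSeries.coeff (Finsupp.single j 1) (S (MvPowerSeries.X i))

theorem coeff_single_sum_X (c : Fin n → ℝ) (j : Fin n) :
    MvPowerSeries.coeff (Finsupp.single j 1) (∑ i, c i • (MvPowerSeries.X i : PS n)) = c j := by
  classical
  rw [map_sum, Finset.sum_eq_single j]
  · simp [MvPowerSeries.coeff_X]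
  · intro i _ hi
    rw [map_smul, MvPowerSeries.coeff_X, if_neg, smul_zero]
    intro h
    exact hi ((Finsupp.single_left_inj one_ne_zero).1 h).symm
  · simp

theorem exists_eq_single_of_degree_eq_one {α : Fin n →₀ ℕ} (h : α.degree = 1) :
    ∃ j, α = Finsupp.single j 1 := by
  have h0 : α ≠ 0 := fun h0 => by simp [h0] at h
  obtain ⟨j, hj⟩ := Finsupp.ne_iff.1 h0
  have hle : Finsupp.single j 1 ≤ α := by
    rw [Finsupp.single_le_iff]
    exact Nat.one_le_iff_ne_zero.2 hj
  have h1 := tsub_add_cancel_of_le hle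
  have h2 := congrArg Finsupp.degree h1
  rw [map_add, Finsupp.degree_single, h] at h2
  have h3 : α - Finsupp.single j 1 = 0 := by
    rw [← Finsupp.degree_eq_zero_iff]; omega
  exact ⟨j, by rw [← h1, h3, zero_add]⟩

theorem sub_linear_mem {a : PS n} (ha : a ∈ ordIdeal n 1) :
    a - ∑ j, MvPowerSeries.coeff (Finsupp.single j 1) a • (MvPowerSeries.X j : PS n) ∈
      ordIdeal n 2 := by
  intro α hα
  by_cases h1 : α.degree < 1
  · exact (sub_mem ha (Submodule.sum_mem _ fun j _ => smul_mem_ordIdeal _ (X_mem_ordIdeal j)) :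
      _ ∈ ordIdeal n 1) α h1
  · have h2 : α.degree = 1 := by omega
    obtain ⟨j, rfl⟩ := exists_eq_single_of_degree_eq_one h2
    rw [map_sub, coeff_single_sum_X, sub_self]

theorem eq_zero_of_sum_smul_X_mem {c : Fin n → ℝ}
    (h : ∑ j, c j • (MvPowerSeries.X j : PS n) ∈ ordIdeal n 2) (j : Fin n) : c j = 0 := by
  rw [← coeff_single_sum_X c j]
  exact h _ (by simp)

theorem pow_apply_X_sub_mem {T : Module.End ℝ (PS n)} (hT : ∀ a ∈ ordIdeal n 2, T a ∈ ordIdeal n 2)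
    {L : Matrix (Fin n) (Fin n) ℝ}
    (h : ∀ i, T (MvPowerSeries.X i) - ∑ j, L i j • (MvPowerSeries.X j : PS n) ∈ ordIdeal n 2)
    (m : ℕ) (i : Fin n) :
    (T ^ m) (MvPowerSeries.X i) - ∑ j, (L ^ m) i j • (MvPowerSeries.X j : PS n) ∈
      ordIdeal n 2 := by
  induction m with
  | zero => simp [Matrix.one_apply]
  | succ m ih =>
    have h1 := hT _ ih
    have h2 : ∑ j, (L ^ m) i j • (T (MvPowerSeries.X j) -
        ∑ k, L j k • (MvPowerSeries.X k : PS n)) ∈ ordIdeal n 2 :=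
      Submodule.sum_mem _ fun j _ => smul_mem_ordIdeal _ (h j)
    have h3 := add_mem h1 h2
    convert h3 using 1
    rw [pow_succ', Module.End.mul_apply, map_sub, map_sum]
    simp only [map_smul, smul_sub, Finset.sum_sub_distrib, Finset.smul_sum, smul_smul,
      pow_succ L, Matrix.mul_apply, Finset.sum_smul]
    rw [Finset.sum_comm]
    abel

theorem aeval_apply_X_sub_mem {T : Module.End ℝ (PS n)}
    (hT : ∀ a ∈ ordIdeal n 2, T a ∈ ordIdeal n 2) {L : Matrix (Fin n) (Fin n) ℝ}
    (h : ∀ i, T (MvPowerSeries.X i) - ∑ j, L i j • (MvPowerSeries.X j : PS n) ∈ ordIdeal n 2)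
    (q : ℝ[X]) (i : Fin n) :
    aeval T q (MvPowerSeries.X i) - ∑ j, (aeval L q) i j • (MvPowerSeries.X j : PS n) ∈
      ordIdeal n 2 := by
  have h1 : ∑ m ∈ Finset.range (q.natDegree + 1), q.coeff m •
      ((T ^ m) (MvPowerSeries.X i) - ∑ j, (L ^ m) i j • (MvPowerSeries.X j : PS n)) ∈
      ordIdeal n 2 :=
    Submodule.sum_mem _ fun m _ => smul_mem_ordIdeal _ (pow_apply_X_sub_mem hT h m i)
  convert h1 using 1
  rw [aeval_eq_sum_range, aeval_eq_sum_range]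
  simp only [LinearMap.sum_apply, LinearMap.smul_apply, smul_sub, Finset.sum_sub_distrib,
    Matrix.sum_apply, Matrix.smul_apply, Finset.sum_smul, Finset.smul_sum, smul_smul, smul_eq_mul]
  rw [Finset.sum_comm]

theorem apply_X_sub_linCoeff_mem {S : Derivation ℝ (PS n) (PS n)}
    (hS : ∀ k, ∀ a ∈ ordIdeal n k, S a ∈ ordIdeal n k) (i : Fin n) :
    S (MvPowerSeries.X i) - ∑ j, linCoeff S i j • (MvPowerSeries.X j : PS n) ∈ ordIdeal n 2 :=
  sub_linear_mem (hS 1 _ (X_mem_ordIdeal i))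

theorem exists_squarefree_aeval_linCoeff {S : Derivation ℝ (PS n) (PS n)}
    (hS : ∀ k, ∀ a ∈ ordIdeal n k, S a ∈ ordIdeal n k)
    (hss : ∀ k, ∃ q : ℝ[X], Squarefree q ∧
        ∀ a, aeval (S : Module.End ℝ (PS n)) q a ∈ ordIdeal n k) :
    ∃ q : ℝ[X], Squarefree q ∧ aeval (linCoeff S) q = 0 := by
  obtain ⟨q, hq, hqS⟩ := hss 2
  refine ⟨q, hq, Matrix.ext fun i j => ?_⟩
  have h1 := aeval_apply_X_sub_mem (T := (S : Module.End ℝ (PS n))) (hS 2)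
    (apply_X_sub_linCoeff_mem hS) q i
  have h2 := sub_mem (hqS (MvPowerSeries.X i)) h1
  rw [sub_sub_cancel] at h2
  exact eq_zero_of_sum_smul_X_mem h2 j

/-- The action of a real matrix on families of formal power series. -/
noncomputable def matrixEnd (L : Matrix (Fin n) (Fin n) ℝ) : Module.End ℝ (Fin n → PS n) :=
  LinearMap.pi fun i => ∑ j, L i j • LinearMap.proj j

theorem matrixEnd_apply (L : Matrix (Fin n) (Fin n) ℝ) (v : Fin n → PS n) (i : Fin n) :
    matrixEnd L v i = ∑ j, L i j • v j := by
  simp [matrixEnd, LinearMap.sum_apply]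

theorem aeval_matrixEnd (L : Matrix (Fin n) (Fin n) ℝ) (q : ℝ[X]) :
    aeval (matrixEnd L) q = matrixEnd (aeval L q) := by
  have hpow : ∀ (m : ℕ), matrixEnd L ^ m = matrixEnd (L ^ m) := by
    intro m
    induction m with
    | zero =>
      refine LinearMap.ext fun v => funext fun i => ?_
      simp [matrixEnd_apply, Matrix.one_apply]
    | succ m ih =>
      refine LinearMap.ext fun v => funext fun i => ?_
      rw [pow_succ, ih, Module.End.mul_apply, matrixEnd_apply, matrixEnd_apply]
      simp only [matrixEnd_apply, pow_succ L, Matrix.mul_apply, Finset.sum_smul, Finset.smul_sum,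
        smul_smul]
      rw [Finset.sum_comm]
  refine LinearMap.ext fun v => funext fun i => ?_
  rw [aeval_eq_sum_range, aeval_eq_sum_range, matrixEnd_apply]
  simp only [hpow, LinearMap.sum_apply, LinearMap.smul_apply, Finset.sum_apply, Pi.smul_apply,
    matrixEnd_apply, Matrix.sum_apply, Matrix.smul_apply, Finset.sum_smul, Finset.smul_sum,
    smul_smul, smul_eq_mul]
  rw [Finset.sum_comm]

/-- **Linearization of a semisimple formal vector field**: there are formal coordinates `y`,
tangent to the given ones, in which `S` is linear. Writing the condition as `Δ y = 0` for the
operator `Δ y = S y - L y` on `n`-tuples of series, which is semisimple modulo every order, the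
coordinate tuple is corrected by successive approximation. -/
theorem exists_linearizing_coordinates {S : Derivation ℝ (PS n) (PS n)}
    (hS : ∀ k, ∀ a ∈ ordIdeal n k, S a ∈ ordIdeal n k)
    (hss : ∀ k, ∃ q : ℝ[X], Squarefree q ∧
        ∀ a, aeval (S : Module.End ℝ (PS n)) q a ∈ ordIdeal n k) :
    ∃ y : Fin n → PS n, (∀ i, y i - MvPowerSeries.X i ∈ ordIdeal n 2) ∧
      ∀ i, S (y i) = ∑ j, linCoeff S i j • y j := by
  set L := linCoeff S
  let T₁ : Module.End ℝ (Fin n → PS n) := LinearMap.compLeft (S : Module.End ℝ (PS n)) (Fin n)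
  have hT₁ : ∀ v i, T₁ v i = S (v i) := fun _ _ => rfl
  let Δ : Module.End ℝ (Fin n → PS n) := T₁ - matrixEnd L
  have hΔ : ∀ v i, Δ v i = S (v i) - ∑ j, L i j • v j := fun v i => by
    simp [Δ, hT₁, matrixEnd_apply]
  have hT₁f : ∀ k, ∀ v ∈ ordSub (Fin n) n k, T₁ v ∈ ordSub (Fin n) n k :=
    fun k v hv i => hS k _ (hv i)
  have hLf : ∀ k, ∀ v ∈ ordSub (Fin n) n k, matrixEnd L v ∈ ordSub (Fin n) n k :=
    fun k v hv i => by
      rw [matrixEnd_apply]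
      exact Submodule.sum_mem _ fun j _ => smul_mem_ordIdeal _ (hv j)
  have hΔf : ∀ k, ∀ v ∈ ordSub (Fin n) n k, Δ v ∈ ordSub (Fin n) n k :=
    fun k v hv => sub_mem (hT₁f k v hv) (hLf k v hv)
  have hcomm : Commute T₁ (matrixEnd L) := by
    refine LinearMap.ext fun v => funext fun i => ?_
    rw [Module.End.mul_apply, Module.End.mul_apply, hT₁, matrixEnd_apply, matrixEnd_apply, map_sum]
    simp only [Derivation.map_smul, hT₁]
  obtain ⟨q₂, hq₂, hLq₂⟩ := exists_squarefree_aeval_linCoeff hS hss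
  have hLq : ∀ v, aeval (matrixEnd L) q₂ v = 0 := by
    intro v
    funext i
    rw [aeval_matrixEnd, hLq₂, matrixEnd_apply]
    simp
  have hr : ∀ k, ∃ r : ℝ[X], ∀ v, Δ v - Δ (Δ (aeval Δ r v)) ∈ ordSub (Fin n) n k := by
    intro k
    obtain ⟨q₁, hq₁, hq₁S⟩ := hss k
    have hT₁q : ∀ v i, aeval T₁ q₁ v i = aeval (S : Module.End ℝ (PS n)) q₁ (v i) := by
      intro v i
      have hpow : ∀ m : ℕ, (T₁ ^ m) v i = ((S : Module.End ℝ (PS n)) ^ m) (v i) := by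
        intro m
        induction m with
        | zero => rfl
        | succ m ih =>
          rw [pow_succ', pow_succ', Module.End.mul_apply, Module.End.mul_apply, hT₁, ih]; rfl
      rw [aeval_eq_sum_range, aeval_eq_sum_range]
      simp only [LinearMap.sum_apply, LinearMap.smul_apply, Finset.sum_apply, Pi.smul_apply, hpow]
    obtain ⟨q, hq, hqΔ⟩ := exists_squarefree_aeval_sub (ordSub (Fin n) n k) (hT₁f k) (hLf k) hcomm
      hq₁ hq₂ (fun v i => by rw [hT₁q]; exact hq₁S _) (fun v => by rw [hLq]; exact zero_mem _)
    exact exists_sub_sq_mem hq hqΔ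
  let x : Fin n → PS n := fun i => MvPowerSeries.X i
  obtain ⟨v, hv, hvx⟩ := successive_approximation Δ (ordSub (Fin n) n)
    (fun w hw => funext fun i => eq_zero_of_forall_mem_ordIdeal fun k => hw k i)
    (fun k l h w hw i => ordIdeal_anti h (hw i)) hΔf (LinearMap.range Δ)
    (by
      rintro k _ ⟨u, rfl⟩ hu
      obtain ⟨r, hr⟩ := hr (k + 1)
      have hcr : Δ (aeval Δ r u) = aeval Δ r (Δ u) := by
        have e := congrArg (fun p => aeval Δ p u) (mul_comm (X : ℝ[X]) r)
        simpa only [map_mul, aeval_X, Module.End.mul_apply] using e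
      refine ⟨Δ (aeval Δ r u), ?_, ⟨u - Δ (aeval Δ r u), map_sub _ _ _⟩, hr u⟩
      rw [hcr]
      exact aeval_mem (hΔf k) r hu)
    2 (Δ x) ⟨x, rfl⟩ (fun i => by
      rw [hΔ]
      exact apply_X_sub_linCoeff_mem hS i)
  refine ⟨x - v, fun i => ?_, fun i => ?_⟩
  · have : (x - v) i - MvPowerSeries.X i = - v i := by
      change MvPowerSeries.X i - v i - MvPowerSeries.X i = _
      ring
    rw [this]
    exact neg_mem (hv i)
  · have : Δ (x - v) = 0 := by rw [map_sub, hvx, sub_self]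
    have := congrFun this i
    rw [hΔ, Pi.zero_apply, sub_eq_zero] at this
    exact this

/-! ### Proportionality of a formal vector field to its semisimple part -/

/-- Two vectors annihilated by the differentials of `n - 1` functionally independent series in `n`
variables are proportional. -/
theorem mul_comm_of_annihilated {F : Fin (n - 1) → PS n}
    (hF : LinearIndependent (PS n) fun i j => MvPowerSeries.pderiv ℝ j (F i)) {d s : Fin n → PS n}
    (hd : ∀ i, ∑ j, MvPowerSeries.pderiv ℝ j (F i) * d j = 0)
    (hs : ∀ i, ∑ j, MvPowerSeries.pderiv ℝ j (F i) * s j = 0) (i j : Fin n) :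
    d i * s j = d j * s i := by
  let K := FractionRing (PS n)
  have hinj : Function.Injective (algebraMap (PS n) K) := IsFractionRing.injective _ _
  let φ : (Fin n → PS n) →ₗ[PS n] (Fin n → K) := (Algebra.linearMap (PS n) K).compLeft (Fin n)
  have hφ : LinearMap.ker φ = ⊥ := by
    rw [LinearMap.ker_eq_bot]
    intro a b hab
    funext k
    exact hinj (congrFun hab k)
  have hF' := hF.map' φ hφ
  rw [LinearIndependent.iff_fractionRing (PS n) K] at hF'
  let M : Matrix (Fin (n - 1)) (Fin n) K :=
    fun i j => algebraMap (PS n) K (MvPowerSeries.pderiv ℝ j (F i))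
  have hM : LinearIndependent K M.row := hF'
  have hrank := hM.rank_matrix
  have hker : Module.finrank K (LinearMap.ker M.mulVecLin) ≤ 1 := by
    have h1 := LinearMap.finrank_range_add_finrank_ker M.mulVecLin
    rw [← Matrix.rank, hrank] at h1
    simp only [Fintype.card_fin, Module.finrank_fintype_fun_eq_card] at h1
    omega
  rw [finrank_le_one_iff] at hker
  obtain ⟨v, hv⟩ := hker
  have hmem : ∀ t : Fin n → PS n, (∀ i, ∑ j, MvPowerSeries.pderiv ℝ j (F i) * t j = 0) →
      φ t ∈ LinearMap.ker M.mulVecLin := by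
    intro t ht
    rw [LinearMap.mem_ker, Matrix.mulVecLin_apply]
    funext i
    have := congrArg (algebraMap (PS n) K) (ht i)
    rw [map_sum, map_zero] at this
    simp only [map_mul] at this
    exact this
  obtain ⟨c₁, h₁⟩ := hv ⟨_, hmem d hd⟩
  obtain ⟨c₂, h₂⟩ := hv ⟨_, hmem s hs⟩
  have h₁' : ∀ k, c₁ * v.1 k = algebraMap (PS n) K (d k) := fun k =>
    congrFun (congrArg Subtype.val h₁) k
  have h₂' : ∀ k, c₂ * v.1 k = algebraMap (PS n) K (s k) := fun k =>
    congrFun (congrArg Subtype.val h₂) k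
  apply hinj
  rw [map_mul, map_mul, ← h₁', ← h₁', ← h₂', ← h₂']
  ring

theorem truncTotal_ne_zero {k : ℕ} {a : PS n} (ha : a ∉ ordIdeal n k) :
    MvPowerSeries.truncTotal k a ≠ 0 := by
  intro h
  have := sub_truncTotal_mem k a
  rw [h] at this
  exact ha (by simpa using this)

/-- Division by a formal power series `u` of order exactly one lowers orders by at most one, because
the lowest homogeneous components of a product multiply. -/
theorem mem_ordIdeal_of_mul_mem {u c : PS n} (hu : u ∈ ordIdeal n 1) (hu' : u ∉ ordIdeal n 2)
    {k : ℕ} (h : u * c ∈ ordIdeal n (k + 1)) : c ∈ ordIdeal n k := by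
  induction k with
  | zero => exact mem_ordIdeal_zero _
  | succ j ih =>
    have hc := ih (ordIdeal_anti (by omega) h)
    have h1 := isHomogeneous_truncTotal hu
    have h2 := isHomogeneous_truncTotal hc
    have h3 := sub_truncTotal_mem 2 u
    have h4 := sub_truncTotal_mem (j + 1) c
    have h5 := truncTotal_ne_zero hu'
    set ℓ := MvPowerSeries.truncTotal (1 + 1) u
    set P := MvPowerSeries.truncTotal (j + 1) c
    have h6 : ℓ * P = 0 := by
      refine eq_zero_of_coe_mem_ordIdeal (h1.mul h2) ?_
      have e : ((ℓ * P : MvPolynomial (Fin n) ℝ) : PS n) =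
          u * c - ((u - ℓ) * c + ℓ * (c - P)) := by
        rw [MvPolynomial.coe_mul]; ring
      rw [e]
      refine sub_mem (ordIdeal_anti (by omega) h) (add_mem ?_ ?_)
      · exact ordIdeal_anti (by omega) (mul_mem_ordIdeal h3 hc)
      · exact ordIdeal_anti (by omega) (mul_mem_ordIdeal (coe_mem_ordIdeal h1) h4)
    have h7 : P = 0 := (mul_eq_zero.1 h6).resolve_left h5
    rw [h7] at h4
    simpa using h4

/-- A nonzero linear form is a prime polynomial. -/
theorem prime_of_isHomogeneous_one {P : MvPolynomial (Fin n) ℝ} (hP : P.IsHomogeneous 1)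
    (h0 : P ≠ 0) : Prime P := by
  refine Irreducible.prime (MvPolynomial.irreducible_of_totalDegree_eq_one (hP.totalDegree h0) ?_)
  intro x hx
  refine isUnit_iff_ne_zero.2 fun hx0 => h0 ?_
  ext α
  have := hx α
  rw [hx0, zero_dvd_iff] at this
  rw [this, MvPolynomial.coeff_zero]

/-- Two formal power series `u`, `v` with independent linear parts are coprime: if `u b = v a`, then
`u` divides `a`. Degree by degree, this is the coprimality of two independent linear forms. -/
theorem exists_eq_mul_of_mul_eq_mul {u v : PS n} (hu : u ∈ ordIdeal n 1) (hv : v ∈ ordIdeal n 1)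
    (hu' : u ∉ ordIdeal n 2) (huv : ∀ r : ℝ, v - r • u ∉ ordIdeal n 2) {a b : PS n}
    (ha : a ∈ ordIdeal n 1) (hb : b ∈ ordIdeal n 1) (h : u * b = v * a) :
    ∃ c, a = c * u := by
  let T : (Unit → PS n) →ₗ[ℝ] PS n × PS n :=
    ((LinearMap.mulRight ℝ u).prod (LinearMap.mulRight ℝ v)) ∘ₗ LinearMap.proj ()
  have hT : ∀ c, T c = (c () * u, c () * v) := fun _ => rfl
  let Wf : ℕ → Submodule ℝ (PS n × PS n) := fun k =>
    ((ordIdeal n (k + 1)).restrictScalars ℝ).prod ((ordIdeal n (k + 1)).restrictScalars ℝ)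
  have hWf : ∀ k w, w ∈ Wf k ↔ w.1 ∈ ordIdeal n (k + 1) ∧ w.2 ∈ ordIdeal n (k + 1) :=
    fun _ _ => Iff.rfl
  let C : Submodule ℝ (PS n × PS n) := LinearMap.ker
    ((LinearMap.mulLeft ℝ u) ∘ₗ LinearMap.snd ℝ _ _ - (LinearMap.mulLeft ℝ v) ∘ₗ
      LinearMap.fst ℝ (PS n) (PS n))
  have hC : ∀ w : PS n × PS n, w ∈ C ↔ u * w.2 = v * w.1 := fun w => by
    rw [LinearMap.mem_ker, LinearMap.sub_apply, sub_eq_zero]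
    rfl
  have hu₁ := isHomogeneous_truncTotal hu
  have hv₁ := isHomogeneous_truncTotal hv
  have hu₂ := sub_truncTotal_mem 2 u
  have hv₂ := sub_truncTotal_mem 2 v
  have hu₃ := truncTotal_ne_zero hu'
  set ℓ := MvPowerSeries.truncTotal (1 + 1) u
  set ℓ' := MvPowerSeries.truncTotal (1 + 1) v
  have hprime := prime_of_isHomogeneous_one hu₁ hu₃
  have hndvd : ¬ ℓ ∣ ℓ' := by
    rintro ⟨e, he⟩
    have hee : ∃ r : ℝ, ℓ' = r • ℓ := by
      by_cases h0 : ℓ' = 0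
      · exact ⟨0, by rw [h0, zero_smul]⟩
      · have he0 : e ≠ 0 := fun h => h0 (by rw [he, h, mul_zero])
        have hdeg := MvPolynomial.totalDegree_mul_of_isDomain hu₃ he0
        rw [← he, hv₁.totalDegree h0, hu₁.totalDegree hu₃] at hdeg
        have hdeg0 : e.totalDegree = 0 := by omega
        obtain ⟨r, hr⟩ : ∃ r, e = MvPolynomial.C r :=
          ⟨_, MvPolynomial.totalDegree_eq_zero_iff_eq_C.mp hdeg0⟩
        exact ⟨r, by rw [he, hr, MvPolynomial.smul_eq_C_mul, mul_comm]⟩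
    obtain ⟨r, hr⟩ := hee
    refine huv r ?_
    have e1 : v - r • u = (v - ℓ') - r • (u - ℓ) := by
      rw [hr, MvPolynomial.coe_smul, smul_sub]; abel
    rw [e1]
    exact sub_mem hv₂ (smul_mem_ordIdeal _ hu₂)
  obtain ⟨c, -, hc⟩ := successive_approximation T Wf
    (fun w hw => Prod.ext
      (eq_zero_of_forall_mem_ordIdeal fun k => ordIdeal_anti (by omega) (hw k).1)
      (eq_zero_of_forall_mem_ordIdeal fun k => ordIdeal_anti (by omega) (hw k).2))
    (fun k l hkl w hw => ⟨ordIdeal_anti (by omega) hw.1, ordIdeal_anti (by omega) hw.2⟩)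
    (fun k c hc => ⟨mul_mem_ordIdeal (hc ()) hu, mul_mem_ordIdeal (hc ()) hv⟩) C
    (by
      rintro k ⟨a, b⟩ hab hm
      rw [hC] at hab
      rw [hWf] at hm
      obtain ⟨ha, hb⟩ := hm
      dsimp only at hab ha hb
      have ha₁ := isHomogeneous_truncTotal ha
      have hb₁ := isHomogeneous_truncTotal hb
      have ha₂ := sub_truncTotal_mem (k + 1 + 1) a
      have hb₂ := sub_truncTotal_mem (k + 1 + 1) b
      set A := MvPowerSeries.truncTotal (k + 1 + 1) a
      set B := MvPowerSeries.truncTotal (k + 1 + 1) b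
      have hAB : ℓ * B = ℓ' * A := by
        rw [← sub_eq_zero]
        refine eq_zero_of_coe_mem_ordIdeal ((hu₁.mul hb₁).sub (hv₁.mul ha₁)) ?_
        have e : ((ℓ * B - ℓ' * A : MvPolynomial (Fin n) ℝ) : PS n) =
            ((v - ℓ') * a + ℓ' * (a - A)) - ((u - ℓ) * b + ℓ * (b - B)) := by
          have e0 : ((ℓ * B - ℓ' * A : MvPolynomial (Fin n) ℝ) : PS n) =
              (ℓ : PS n) * B - ℓ' * A := by
            rw [← MvPolynomial.coe_mul, ← MvPolynomial.coe_mul]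
            exact map_sub (MvPolynomial.coeToMvPowerSeries.ringHom (R := ℝ) (σ := Fin n)) _ _
          rw [e0]
          linear_combination hab
        rw [e]
        refine sub_mem (add_mem ?_ ?_) (add_mem ?_ ?_)
        · exact ordIdeal_anti (by omega) (mul_mem_ordIdeal hv₂ ha)
        · exact ordIdeal_anti (by omega) (mul_mem_ordIdeal (coe_mem_ordIdeal hv₁) ha₂)
        · exact ordIdeal_anti (by omega) (mul_mem_ordIdeal hu₂ hb)
        · exact ordIdeal_anti (by omega) (mul_mem_ordIdeal (coe_mem_ordIdeal hu₁) hb₂)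
      obtain ⟨c, hc⟩ := (hprime.dvd_or_dvd ⟨B, hAB.symm⟩).resolve_left hndvd
      have hB : B = ℓ' * c := mul_left_cancel₀ hu₃ (by rw [hAB, hc]; ring)
      have hcm : (c : PS n) ∈ ordIdeal n k := by
        refine mem_ordIdeal_of_mul_mem (coe_mem_ordIdeal hu₁)
          (fun h => hu₃ (eq_zero_of_coe_mem_ordIdeal hu₁ h)) ?_
        rw [← MvPolynomial.coe_mul, ← hc]
        exact coe_mem_ordIdeal ha₁
      refine ⟨fun _ => c, fun _ => hcm, ?_, ?_⟩
      · rw [hC, hT]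
        simp only [Prod.mk_sub_mk]
        linear_combination hab
      · rw [hWf, hT]
        simp only [Prod.mk_sub_mk]
        constructor
        · have e : a - c * u = (a - A) - c * (u - ℓ) := by
            rw [hc, MvPolynomial.coe_mul]; ring
          rw [e]
          exact sub_mem ha₂ (ordIdeal_anti (by omega) (mul_mem_ordIdeal hcm hu₂))
        · have e : b - c * v = (b - B) - c * (v - ℓ') := by
            rw [hB, MvPolynomial.coe_mul]; ring
          rw [e]
          exact sub_mem hb₂ (ordIdeal_anti (by omega) (mul_mem_ordIdeal hcm hv₂)))
    0 (a, b) ((hC _).2 h) ⟨ha, hb⟩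
  exact ⟨c (), (congrArg Prod.fst hc).symm⟩

/-- An element that is both semisimple and nilpotent vanishes: iterating `L = L² r(L)` gives
`L = L ^ (m + 1) r(L) ^ m` for all `m`. -/
theorem eq_zero_of_pow_eq_zero_of_squarefree {R : Type*} [Ring R] [Algebra ℝ R] {L : R} {q : ℝ[X]}
    (hq : Squarefree q) (hL : aeval L q = 0) {M : ℕ} (hM : L ^ M = 0) : L = 0 := by
  obtain ⟨r, c, hr⟩ := exists_dvd_X_sub_sq hq
  have h1 : L = L ^ 2 * aeval L r := by
    have := congrArg (aeval L) hr
    simp only [map_sub, map_mul, map_pow, aeval_X, hL, zero_mul] at this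
    exact sub_eq_zero.1 this
  have hc : Commute L (aeval L r) := by
    have e := congrArg (aeval L) (mul_comm (X : ℝ[X]) r)
    simp only [map_mul, aeval_X] at e
    exact e
  have h2 : ∀ m : ℕ, L = L ^ (m + 1) * aeval L r ^ m := by
    intro m
    induction m with
    | zero => simp
    | succ m ih =>
      calc L = L ^ 2 * aeval L r := h1
        _ = L * (L * aeval L r) := by rw [pow_two, mul_assoc]
        _ = (L ^ (m + 1) * aeval L r ^ m) * (L * aeval L r) := by rw [← ih]
        _ = L ^ (m + 1) * ((aeval L r ^ m * L) * aeval L r) := by simp only [mul_assoc]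
        _ = L ^ (m + 1) * ((L * aeval L r ^ m) * aeval L r) := by rw [(hc.pow_right m).eq]
        _ = _ := by rw [pow_succ L (m + 1), pow_succ (aeval L r)]; simp only [mul_assoc]
  rw [h2 M, pow_succ, hM, zero_mul, zero_mul]

/-- The Jacobian matrix of a formal coordinate system tangent to the identity is invertible. -/
theorem isUnit_det_jacobian {y : Fin n → PS n}
    (hy : ∀ i, y i - MvPowerSeries.X i ∈ ordIdeal n 2) :
    IsUnit (Matrix.of fun i j => MvPowerSeries.pderiv ℝ j (y i)).det := by
  classical
  rw [MvPowerSeries.isUnit_iff_constantCoeff, RingHom.map_det]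
  have : (MvPowerSeries.constantCoeff (σ := Fin n) (R := ℝ)).mapMatrix
      (Matrix.of fun i j => MvPowerSeries.pderiv ℝ j (y i)) = 1 := by
    refine Matrix.ext fun i j => ?_
    have h1 := mem_ordIdeal_one.1 (pderiv_mem_ordIdeal j (hy i))
    rw [map_sub, map_sub, sub_eq_zero] at h1
    rw [RingHom.mapMatrix_apply, Matrix.map_apply, Matrix.of_apply, h1, MvPowerSeries.pderiv_X,
      Matrix.one_apply]
    by_cases h : i = j
    · subst h; simp
    · simp [h]
  rw [this, Matrix.det_one]
  exact isUnit_one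

/-- A formal vector field whose values on formal coordinates lie in an ideal takes all its values
in that ideal. -/
theorem apply_mem_of_forall_coordinates {S : Derivation ℝ (PS n) (PS n)}
    (hS : ∀ k, ∀ a ∈ ordIdeal n k, S a ∈ ordIdeal n k) {y : Fin n → PS n}
    (hy : ∀ i, y i - MvPowerSeries.X i ∈ ordIdeal n 2) {I : Ideal (PS n)} (hI : ∀ i, S (y i) ∈ I)
    (a : PS n) : S a ∈ I := by
  classical
  set J : Matrix (Fin n) (Fin n) (PS n) := Matrix.of fun i j => MvPowerSeries.pderiv ℝ j (y i)
  have hJ : IsUnit J.det := isUnit_det_jacobian hy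
  have h1 : (fun i => S (y i)) = J.mulVec fun j => S (MvPowerSeries.X j) := by
    funext i
    exact derivation_eq_sum_pderiv S hS (y i)
  have h2 : J⁻¹.mulVec (fun i => S (y i)) = fun j => S (MvPowerSeries.X j) := by
    rw [h1, Matrix.mulVec_mulVec, Matrix.nonsing_inv_mul J hJ, Matrix.one_mulVec]
  rw [derivation_eq_sum_pderiv S hS a]
  refine Submodule.sum_mem _ fun j _ => Ideal.mul_mem_left _ _ ?_
  rw [← congrFun h2 j]
  change ∑ i, J⁻¹ j i * S (y i) ∈ I
  exact Submodule.sum_mem _ fun i _ => Ideal.mul_mem_left _ _ (hI i)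

theorem sum_smul_coordinates_sub_mem {y : Fin n → PS n}
    (hy : ∀ i, y i - MvPowerSeries.X i ∈ ordIdeal n 2) (c : Fin n → ℝ) :
    ∑ j, c j • y j - ∑ j, c j • (MvPowerSeries.X j : PS n) ∈ ordIdeal n 2 := by
  rw [← Finset.sum_sub_distrib]
  refine Submodule.sum_mem _ fun j _ => ?_
  rw [← smul_sub]
  exact smul_mem_ordIdeal _ (hy j)

/-- A formal vector field `D` that is proportional over the fraction field to its nonzero
semisimple part `S`, linear in the formal coordinates `y`, is a multiple of `S` by a formal power
series. If `S` has rank at least two this is a coprimality argument; if it has rank one, its image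
lies in the principal ideal generated by an eigenvector `w`, whence `D w` is divisible by `w`. -/
theorem exists_ratio {D S : Derivation ℝ (PS n) (PS n)}
    (hD : ∀ k, ∀ a ∈ ordIdeal n k, D a ∈ ordIdeal n k)
    (hS : ∀ k, ∀ a ∈ ordIdeal n k, S a ∈ ordIdeal n k)
    (hc : Commute (D : Module.End ℝ (PS n)) (S : Module.End ℝ (PS n)))
    {L : Matrix (Fin n) (Fin n) ℝ} (hL0 : L ≠ 0)
    {q : ℝ[X]} (hq : Squarefree q) (hqL : aeval L q = 0)
    {y : Fin n → PS n} (hy : ∀ i, y i - MvPowerSeries.X i ∈ ordIdeal n 2)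
    (hSy : ∀ i, S (y i) = ∑ j, L i j • y j)
    (hprop : ∀ u v, D u * S v = D v * S u) :
    ∃ g : PS n, ∀ i, D (y i) = g * S (y i) := by
  have hyI : ∀ i, y i ∈ ordIdeal n 1 := fun i => by
    have := add_mem (ordIdeal_anti (by omega) (hy i)) (X_mem_ordIdeal i)
    rwa [sub_add_cancel] at this
  have hSyne : ∀ c : Fin n → ℝ, c ≠ 0 → ∑ j, c j • y j ∉ ordIdeal n 2 := by
    intro c hc0 h
    have h1 := sub_mem h (sum_smul_coordinates_sub_mem hy c)
    rw [sub_sub_cancel] at h1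
    exact hc0 (funext fun j => eq_zero_of_sum_smul_X_mem h1 j)
  have hrow : ∃ i₁, L i₁ ≠ 0 := by
    by_contra! h
    exact hL0 (funext h)
  obtain ⟨i₁, hi₁⟩ := hrow
  by_cases hrank : ∀ i, ∃ μ : ℝ, L i = μ • L i₁
  · -- rank one: all `S (y i)` are multiples of an eigenvector `w`, whose eigenvalue `t` is nonzero
    -- because otherwise `L ^ 2 = 0`
    choose μ hμ using hrank
    set w := S (y i₁) with hw
    have hSyw : ∀ i, S (y i) = μ i • w := by
      intro i
      rw [hw, hSy, hSy, hμ i, Finset.smul_sum]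
      refine Finset.sum_congr rfl fun j _ => ?_
      rw [Pi.smul_apply, smul_smul, smul_eq_mul]
    set t : ℝ := ∑ j, L i₁ j * μ j with ht
    have hSw : S w = t • w := by
      have e : S w = ∑ j, L i₁ j • S (y j) := by
        rw [hw, hSy, map_sum]
        exact Finset.sum_congr rfl fun j _ => Derivation.map_smul _ _ _
      rw [e, ht, Finset.sum_smul]
      exact Finset.sum_congr rfl fun j _ => by rw [hSyw, smul_smul]
    have ht0 : t ≠ 0 := by
      intro h0
      refine hL0 (eq_zero_of_pow_eq_zero_of_squarefree hq hqL (M := 2) (Matrix.ext fun i k => ?_))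
      rw [pow_two, Matrix.mul_apply, Matrix.zero_apply]
      calc ∑ j, L i j * L j k = ∑ j, (μ i * L i₁ k) * (L i₁ j * μ j) := by
            refine Finset.sum_congr rfl fun j _ => ?_
            rw [hμ i, hμ j, Pi.smul_apply, Pi.smul_apply, smul_eq_mul, smul_eq_mul]
            ring
        _ = 0 := by rw [← Finset.mul_sum, ← ht, h0, mul_zero]
    have hw0 : w ≠ 0 := by
      intro h0
      refine hSyne (L i₁) hi₁ ?_
      rw [← hSy, ← hw, h0]
      exact zero_mem _
    have hmem : ∀ a, S a ∈ Ideal.span {w} :=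
      apply_mem_of_forall_coordinates hS hy fun i => by
        rw [hSyw, Algebra.smul_def]
        exact Ideal.mul_mem_left _ _ (Ideal.mem_span_singleton_self w)
    obtain ⟨h, hh⟩ := Ideal.mem_span_singleton'.1 (hmem (D w))
    have hDw : t • D w = h * w := by
      rw [hh, ← Derivation.map_smul, ← hSw]
      exact LinearMap.congr_fun hc.eq w
    have hSw0 : S w ≠ 0 := by
      rw [hSw]
      exact smul_ne_zero ht0 hw0
    refine ⟨(t⁻¹ * t⁻¹) • h, fun j => mul_right_cancel₀ hSw0 ?_⟩
    have e1 : D w = ((t⁻¹ * t⁻¹) • h) * S w := by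
      rw [hSw, smul_mul_smul_comm, ← hDw, smul_smul]
      have : t⁻¹ * t⁻¹ * t * t = 1 := by field_simp
      rw [this, one_smul]
    rw [hprop (y j) w, e1]
    ring
  · push Not at hrank
    obtain ⟨i₂, hi₂⟩ := hrank
    have hu : S (y i₁) ∈ ordIdeal n 1 := hS 1 _ (hyI _)
    have hv : S (y i₂) ∈ ordIdeal n 1 := hS 1 _ (hyI _)
    have hu' : S (y i₁) ∉ ordIdeal n 2 := by
      rw [hSy]; exact hSyne _ hi₁
    obtain ⟨c, hc⟩ := exists_eq_mul_of_mul_eq_mul hu hv hu' (fun r => by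
      have : S (y i₂) - r • S (y i₁) = ∑ j, (L i₂ - r • L i₁) j • y j := by
        rw [hSy, hSy, Finset.smul_sum, ← Finset.sum_sub_distrib]
        refine Finset.sum_congr rfl fun j _ => ?_
        rw [Pi.sub_apply, Pi.smul_apply, sub_smul, smul_smul, smul_eq_mul]
      rw [this]
      exact hSyne _ (sub_ne_zero.2 (hi₂ r))) (hD 1 _ (hyI i₁)) (hD 1 _ (hyI i₂))
      (show S (y i₁) * D (y i₂) = S (y i₂) * D (y i₁) by
        rw [mul_comm, hprop (y i₂) (y i₁), mul_comm])
    refine ⟨c, fun j => mul_right_cancel₀ (b := S (y i₁)) (fun h => hu' ?_) ?_⟩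
    · rw [h]; exact zero_mem _
    · rw [hprop (y j) (y i₁), hc]; ring

/-- The ratio `g` of `D` to its semisimple part `S` is a first integral of `S`. -/
theorem apply_ratio_eq_zero {D S : Derivation ℝ (PS n) (PS n)}
    (hc : Commute (D : Module.End ℝ (PS n)) (S : Module.End ℝ (PS n)))
    {L : Matrix (Fin n) (Fin n) ℝ} {y : Fin n → PS n} (hSy : ∀ i, S (y i) = ∑ j, L i j • y j)
    {g : PS n} (hg : ∀ i, D (y i) = g * S (y i)) (hne : ∃ i, S (y i) ≠ 0) : S g = 0 := by
  obtain ⟨i, hi⟩ := hne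
  have h1 : D (S (y i)) = S (D (y i)) := LinearMap.congr_fun hc.eq (y i)
  have h2 : D (S (y i)) = g * S (S (y i)) := by
    rw [hSy, map_sum, map_sum, Finset.mul_sum]
    refine Finset.sum_congr rfl fun j _ => ?_
    rw [Derivation.map_smul, Derivation.map_smul, hg, mul_smul_comm]
  rw [h2, hg, Derivation.leibniz, smul_eq_mul, smul_eq_mul, left_eq_add] at h1
  exact (mul_eq_zero.1 h1).resolve_left hi

/-- The ratio `g` of `D` to its nonzero semisimple part `S` has constant term `1`: the linear part
of the nilpotent operator `D - S` is `g(0) - 1` times that of the semisimple `S`. -/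
theorem constantCoeff_ratio {D S : Derivation ℝ (PS n) (PS n)}
    (hD : ∀ k, ∀ a ∈ ordIdeal n k, D a ∈ ordIdeal n k)
    (hS : ∀ k, ∀ a ∈ ordIdeal n k, S a ∈ ordIdeal n k)
    (hnil : ∀ k, ∃ M : ℕ, ∀ a,
        (((D : Module.End ℝ (PS n)) - (S : Module.End ℝ (PS n))) ^ M) a ∈ ordIdeal n k)
    (hL0 : linCoeff S ≠ 0) {q : ℝ[X]} (hq : Squarefree q) (hqL : aeval (linCoeff S) q = 0)
    {y : Fin n → PS n} (hy : ∀ i, y i - MvPowerSeries.X i ∈ ordIdeal n 2)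
    {g : PS n} (hg : ∀ i, D (y i) = g * S (y i)) :
    MvPowerSeries.constantCoeff g = 1 := by
  by_contra hne
  set g₀ := MvPowerSeries.constantCoeff g with hg₀
  obtain ⟨M, hM⟩ := hnil 2
  have hlin : ∀ i, ((D : Module.End ℝ (PS n)) - (S : Module.End ℝ (PS n))) (MvPowerSeries.X i) -
      ∑ j, ((g₀ - 1) • linCoeff S) i j • (MvPowerSeries.X j : PS n) ∈ ordIdeal n 2 := by
    intro i
    have h1 := hD 2 _ (hy i)
    have h2 := hS 2 _ (hy i)
    have h3 : g - MvPowerSeries.C g₀ ∈ ordIdeal n 1 := by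
      rw [mem_ordIdeal_one, map_sub, MvPowerSeries.constantCoeff_C, hg₀, sub_self]
    have h4 := mul_mem_ordIdeal h3 (hS 1 _ (X_mem_ordIdeal i))
    have h5 := smul_mem_ordIdeal (g₀ - 1) (apply_X_sub_linCoeff_mem hS i)
    rw [map_sub] at h1 h2
    have h6 := Ideal.mul_mem_left _ g h2
    have h7 := add_mem (add_mem (sub_mem h6 h1) h4) h5
    have e1 : ∑ j, ((g₀ - 1) • linCoeff S) i j • (MvPowerSeries.X j : PS n) =
        (g₀ - 1) • ∑ j, linCoeff S i j • (MvPowerSeries.X j : PS n) := by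
      rw [Finset.smul_sum]
      exact Finset.sum_congr rfl fun j _ => by rw [smul_smul]; rfl
    have e2 : (g₀ - 1) • S (MvPowerSeries.X i) =
        MvPowerSeries.C g₀ * S (MvPowerSeries.X i) - S (MvPowerSeries.X i) := by
      rw [sub_smul, one_smul, MvPowerSeries.smul_eq_C_mul]
    convert h7 using 1
    rw [e1, hg, smul_sub, e2, LinearMap.sub_apply, Derivation.coeFn_coe, Derivation.coeFn_coe]
    ring
  have hfil : ∀ a ∈ ordIdeal n 2,
      ((D : Module.End ℝ (PS n)) - (S : Module.End ℝ (PS n))) a ∈ ordIdeal n 2 :=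
    fun a ha => sub_mem (hD 2 a ha) (hS 2 a ha)
  have hpow : (linCoeff S) ^ M = 0 := by
    refine Matrix.ext fun i j => ?_
    have h1 := sub_mem (hM (MvPowerSeries.X i)) (pow_apply_X_sub_mem hfil hlin M i)
    rw [sub_sub_cancel] at h1
    have h2 := eq_zero_of_sum_smul_X_mem h1 j
    rw [_root_.smul_pow, Matrix.smul_apply, smul_eq_mul] at h2
    exact (mul_eq_zero.1 h2).resolve_left (pow_ne_zero _ (sub_ne_zero.2 hne))
  exact hL0 (eq_zero_of_pow_eq_zero_of_squarefree hq hqL hpow)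

/-- If the linear part of `D` is not nilpotent, then the semisimple part of `D` has a nonzero
linear part. -/
theorem linCoeff_ne_zero {D S : Derivation ℝ (PS n) (PS n)}
    (hD : ∀ k, ∀ a ∈ ordIdeal n k, D a ∈ ordIdeal n k)
    (hS : ∀ k, ∀ a ∈ ordIdeal n k, S a ∈ ordIdeal n k)
    (hnil : ∀ k, ∃ M : ℕ, ∀ a,
        (((D : Module.End ℝ (PS n)) - (S : Module.End ℝ (PS n))) ^ M) a ∈ ordIdeal n k)
    (hlin : ¬ IsNilpotent (linCoeff D)) : linCoeff S ≠ 0 := by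
  intro h0
  obtain ⟨M, hM⟩ := hnil 2
  refine hlin ⟨M, Matrix.ext fun i j => ?_⟩
  have h1 := pow_apply_X_sub_mem (T := (D : Module.End ℝ (PS n)) - (S : Module.End ℝ (PS n)))
    (L := linCoeff D) (fun a ha => sub_mem (hD 2 a ha) (hS 2 a ha)) (fun i => by
      have h1 := apply_X_sub_linCoeff_mem hD i
      have h2 := apply_X_sub_linCoeff_mem hS i
      simp only [h0, Matrix.zero_apply, zero_smul, Finset.sum_const_zero, sub_zero] at h2
      have h3 := sub_mem h1 h2
      convert h3 using 1
      rw [LinearMap.sub_apply, Derivation.coeFn_coe, Derivation.coeFn_coe]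
      ring) M i
  have h2 := sub_mem (hM (MvPowerSeries.X i)) h1
  rw [sub_sub_cancel] at h2
  exact eq_zero_of_sum_smul_X_mem h2 j

/-! ### Polynomial first integrals of a linear vector field -/

/-- The linear vector field `∑ (L x)ᵢ ∂ᵢ` acting on polynomials. -/
noncomputable def linDer (L : Matrix (Fin n) (Fin n) ℝ) :
    Derivation ℝ (MvPolynomial (Fin n) ℝ) (MvPolynomial (Fin n) ℝ) :=
  MvPolynomial.mkDerivation ℝ fun i => ∑ j, L i j • MvPolynomial.X j

theorem linDer_apply (L : Matrix (Fin n) (Fin n) ℝ) (P : MvPolynomial (Fin n) ℝ) :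
    linDer L P = ∑ i, MvPolynomial.pderiv i P * ∑ j, L i j • MvPolynomial.X j := by
  have := derivation_aeval (linDer L) MvPolynomial.X P
  simp only [MvPolynomial.aeval_X_left, AlgHom.id_apply] at this
  rw [this]
  simp only [linDer, MvPolynomial.mkDerivation_X]

theorem isHomogeneous_linDer (L : Matrix (Fin n) (Fin n) ℝ) {d : ℕ}
    {P : MvPolynomial (Fin n) ℝ} (hP : P.IsHomogeneous d) : (linDer L P).IsHomogeneous d := by
  rw [linDer_apply]
  refine MvPolynomial.IsHomogeneous.sum _ _ _ fun i _ => ?_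
  have h1 : (∑ j, L i j • MvPolynomial.X j : MvPolynomial (Fin n) ℝ).IsHomogeneous 1 :=
    MvPolynomial.IsHomogeneous.sum _ _ _ fun j _ => by
      rw [MvPolynomial.smul_eq_C_mul]
      exact (MvPolynomial.isHomogeneous_X ℝ j).C_mul _
  cases d with
  | zero =>
    have : MvPolynomial.pderiv i P = 0 := by
      rw [← MvPolynomial.totalDegree_zero_iff_isHomogeneous,
        MvPolynomial.totalDegree_eq_zero_iff_eq_C] at hP
      rw [hP, MvPolynomial.pderiv_C]
    rw [this, zero_mul]
    exact MvPolynomial.isHomogeneous_zero _ _ _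
  | succ d => exact hP.pderiv.mul h1

/-- In coordinates `y` in which `S` is linear with matrix `L`, it acts on polynomials as
`linDer L`. -/
theorem apply_aeval_eq_aeval_linDer {S : Derivation ℝ (PS n) (PS n)}
    {L : Matrix (Fin n) (Fin n) ℝ} {y : Fin n → PS n} (hSy : ∀ i, S (y i) = ∑ j, L i j • y j)
    (P : MvPolynomial (Fin n) ℝ) :
    S (MvPolynomial.aeval y P) = MvPolynomial.aeval y (linDer L P) := by
  rw [derivation_aeval, linDer_apply, map_sum]
  refine Finset.sum_congr rfl fun i _ => ?_
  rw [map_mul, hSy, map_sum]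
  simp only [map_smul, MvPolynomial.aeval_X]

theorem aeval_monomial_mem {y : Fin n → PS n} (hy : ∀ i, y i - MvPowerSeries.X i ∈ ordIdeal n 2)
    (α : Fin n →₀ ℕ) :
    MvPolynomial.aeval y (MvPolynomial.monomial α (1 : ℝ)) ∈ ordIdeal n α.degree ∧
    MvPolynomial.aeval y (MvPolynomial.monomial α (1 : ℝ)) -
      (MvPolynomial.monomial α (1 : ℝ) : MvPolynomial (Fin n) ℝ) ∈
        ordIdeal n (α.degree + 1) := by
  have hadd : ∀ α β : Fin n →₀ ℕ,
      (MvPolynomial.aeval y (MvPolynomial.monomial α (1 : ℝ)) ∈ ordIdeal n α.degree ∧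
        MvPolynomial.aeval y (MvPolynomial.monomial α (1 : ℝ)) -
        (MvPolynomial.monomial α (1 : ℝ) : MvPolynomial (Fin n) ℝ) ∈
        ordIdeal n (α.degree + 1)) →
      (MvPolynomial.aeval y (MvPolynomial.monomial β (1 : ℝ)) ∈ ordIdeal n β.degree ∧
        MvPolynomial.aeval y (MvPolynomial.monomial β (1 : ℝ)) -
        (MvPolynomial.monomial β (1 : ℝ) : MvPolynomial (Fin n) ℝ) ∈
        ordIdeal n (β.degree + 1)) →
      (MvPolynomial.aeval y (MvPolynomial.monomial (α + β) (1 : ℝ)) ∈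
        ordIdeal n (α + β).degree ∧
        MvPolynomial.aeval y (MvPolynomial.monomial (α + β) (1 : ℝ)) -
        (MvPolynomial.monomial (α + β) (1 : ℝ) : MvPolynomial (Fin n) ℝ) ∈
        ordIdeal n ((α + β).degree + 1)) := by
    rintro α β ⟨h1, h2⟩ ⟨h3, h4⟩
    have e : (MvPolynomial.monomial (α + β) (1 : ℝ) : MvPolynomial (Fin n) ℝ) =
        MvPolynomial.monomial α 1 * MvPolynomial.monomial β 1 := by
      rw [MvPolynomial.monomial_mul, one_mul]
    have hα : ((MvPolynomial.monomial α (1 : ℝ) : MvPolynomial (Fin n) ℝ) : PS n) ∈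
        ordIdeal n α.degree := by
      have := sub_mem h1 (ordIdeal_anti (by omega) h2)
      rwa [sub_sub_cancel] at this
    rw [e, map_mul, map_add, MvPolynomial.coe_mul]
    refine ⟨mul_mem_ordIdeal h1 h3, ?_⟩
    have h5 := add_mem (ordIdeal_anti (k := α.degree + 1 + β.degree)
      (j := α.degree + β.degree + 1) (by omega) (mul_mem_ordIdeal h2 h3))
      (ordIdeal_anti (by omega) (mul_mem_ordIdeal hα h4))
    convert h5 using 1
    ring
  induction α using Finsupp.induction_linear with
  | zero => simp [mem_ordIdeal_zero]
  | add α β hα hβ => exact hadd α β hα hβ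
  | single i m =>
    induction m with
    | zero => simp [mem_ordIdeal_zero]
    | succ m ih =>
      rw [Finsupp.single_add]
      refine hadd _ _ ih ?_
      have h1 : MvPolynomial.aeval y (MvPolynomial.monomial (Finsupp.single i 1) (1 : ℝ)) =
          y i := MvPolynomial.aeval_X y i
      have h2 : ((MvPolynomial.monomial (Finsupp.single i 1) (1 : ℝ) :
          MvPolynomial (Fin n) ℝ) : PS n) = MvPowerSeries.X i := MvPolynomial.coe_X i
      rw [h1, h2, Finsupp.degree_single]
      refine ⟨?_, hy i⟩
      have := add_mem (ordIdeal_anti (by omega) (hy i)) (X_mem_ordIdeal i)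
      rwa [sub_add_cancel] at this

/-- Replacing the coordinates by formal coordinates tangent to them changes a homogeneous
polynomial of degree `d` by terms of order `d + 1` only. -/
theorem aeval_sub_coe_mem {y : Fin n → PS n} (hy : ∀ i, y i - MvPowerSeries.X i ∈ ordIdeal n 2)
    {d : ℕ} {P : MvPolynomial (Fin n) ℝ} (hP : P.IsHomogeneous d) :
    MvPolynomial.aeval y P - (P : PS n) ∈ ordIdeal n (d + 1) := by
  have h1 : P = ∑ α ∈ P.support, P.coeff α • MvPolynomial.monomial α (1 : ℝ) := by
    conv_lhs => rw [P.as_sum]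
    refine Finset.sum_congr rfl fun α _ => ?_
    rw [MvPolynomial.smul_monomial, smul_eq_mul, mul_one]
  have h2 : MvPolynomial.aeval y P - (P : PS n) = ∑ α ∈ P.support, P.coeff α •
      (MvPolynomial.aeval y (MvPolynomial.monomial α (1 : ℝ)) -
        ((MvPolynomial.monomial α (1 : ℝ) : MvPolynomial (Fin n) ℝ) : PS n)) := by
    have key : ∀ Q : MvPolynomial (Fin n) ℝ, MvPolynomial.aeval y Q - (Q : PS n) =
        ((MvPolynomial.aeval y : MvPolynomial (Fin n) ℝ →ₐ[ℝ] PS n).toLinearMap -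
          (MvPolynomial.aeval (fun i => (MvPowerSeries.X i : PS n)) :
            MvPolynomial (Fin n) ℝ →ₐ[ℝ] PS n).toLinearMap) Q := fun Q => by
      rw [← aeval_X_eq_coe]; rfl
    simp only [key]
    conv_lhs => rw [h1]
    simp only [map_sum, map_smul]
  rw [h2]
  refine Submodule.sum_mem _ fun α hα => smul_mem_ordIdeal _ ?_
  have := (aeval_monomial_mem hy α).2
  rwa [show α.degree = d from ?_] at this
  by_contra hne
  exact (MvPolynomial.mem_support_iff.1 hα) (hP.coeff_eq_zero hne)

/-- In linearizing coordinates `y`, every formal first integral of `S` is a sum of homogeneous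
polynomials in `y` that are first integrals of the linear vector field. -/
theorem exists_invariant_expansion {S : Derivation ℝ (PS n) (PS n)}
    (hS : ∀ k, ∀ a ∈ ordIdeal n k, S a ∈ ordIdeal n k) {L : Matrix (Fin n) (Fin n) ℝ}
    {y : Fin n → PS n} (hy : ∀ i, y i - MvPowerSeries.X i ∈ ordIdeal n 2)
    (hSy : ∀ i, S (y i) = ∑ j, L i j • y j) {g : PS n} (hg : S g = 0) :
    ∃ P : ℕ → MvPolynomial (Fin n) ℝ, (∀ d, (P d).IsHomogeneous d) ∧ (∀ d, linDer L (P d) = 0) ∧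
      ∀ K, g - ∑ d ∈ Finset.range K, MvPolynomial.aeval y (P d) ∈ ordIdeal n K := by
  -- `e d` is the part of `g` of order at least `d` in the coordinates `y`
  let e : ℕ → PS n := fun d => Nat.rec g
    (fun d a => a - MvPolynomial.aeval y (MvPowerSeries.truncTotal (d + 1) a)) d
  have he0 : e 0 = g := rfl
  have hes : ∀ d, e (d + 1) =
      e d - MvPolynomial.aeval y (MvPowerSeries.truncTotal (d + 1) (e d)) := fun _ => rfl
  have hstep : ∀ (d : ℕ) (a : PS n), a ∈ ordIdeal n d → S a = 0 →
      a - MvPolynomial.aeval y (MvPowerSeries.truncTotal (d + 1) a) ∈ ordIdeal n (d + 1) ∧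
      linDer L (MvPowerSeries.truncTotal (d + 1) a) = 0 := by
    intro d a ha hSa
    have hP := isHomogeneous_truncTotal ha
    have h1 := sub_truncTotal_mem (d + 1) a
    set P := MvPowerSeries.truncTotal (d + 1) a
    have h2 := sub_mem h1 (aeval_sub_coe_mem hy hP)
    rw [sub_sub_sub_cancel_right] at h2
    refine ⟨h2, eq_zero_of_coe_mem_ordIdeal (isHomogeneous_linDer L hP) ?_⟩
    have h3 := hS _ _ h2
    rw [map_sub, hSa, zero_sub, apply_aeval_eq_aeval_linDer hSy] at h3
    have h4 := neg_mem (add_mem (aeval_sub_coe_mem hy (isHomogeneous_linDer L hP)) h3)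
    convert h4 using 1
    ring
  have hinv : ∀ d, e d ∈ ordIdeal n d ∧ S (e d) = 0 := by
    intro d
    induction d with
    | zero => exact ⟨mem_ordIdeal_zero _, hg⟩
    | succ d ih =>
      obtain ⟨h1, h2⟩ := hstep d _ ih.1 ih.2
      rw [hes]
      refine ⟨h1, ?_⟩
      rw [map_sub, ih.2, apply_aeval_eq_aeval_linDer hSy, h2, map_zero, sub_zero]
  refine ⟨fun d => MvPowerSeries.truncTotal (d + 1) (e d),
    fun d => isHomogeneous_truncTotal (hinv d).1,
    fun d => (hstep d _ (hinv d).1 (hinv d).2).2, fun K => ?_⟩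
  have hsum : ∀ K, g - ∑ d ∈ Finset.range K,
      MvPolynomial.aeval y (MvPowerSeries.truncTotal (d + 1) (e d)) = e K := by
    intro K
    induction K with
    | zero => simp [he0]
    | succ K ih => rw [Finset.sum_range_succ, ← sub_sub, ih, hes]
  rw [hsum]
  exact (hinv K).1

/-- On homogeneous polynomials the linear vector field with matrix `L` is semisimple if the formal
vector field `S` which it represents is. -/
theorem exists_linDer_eq {S : Derivation ℝ (PS n) (PS n)}
    (hss : ∀ k, ∃ q : ℝ[X], Squarefree q ∧
        ∀ a, aeval (S : Module.End ℝ (PS n)) q a ∈ ordIdeal n k)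
    {L : Matrix (Fin n) (Fin n) ℝ}
    {y : Fin n → PS n} (hy : ∀ i, y i - MvPowerSeries.X i ∈ ordIdeal n 2)
    (hSy : ∀ i, S (y i) = ∑ j, L i j • y j) (d : ℕ) :
    ∃ r : ℝ[X], ∀ P : MvPolynomial (Fin n) ℝ, P.IsHomogeneous d →
      linDer L P = linDer L (linDer L
        (aeval (linDer L : Module.End ℝ (MvPolynomial (Fin n) ℝ)) r P)) := by
  obtain ⟨q, hq, hqS⟩ := hss (d + 1)
  obtain ⟨r, c, hr⟩ := exists_dvd_X_sub_sq hq
  refine ⟨r, fun P hP => ?_⟩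
  have hpow : ∀ (m : ℕ) (P : MvPolynomial (Fin n) ℝ), MvPolynomial.aeval y
      (((linDer L : Module.End ℝ (MvPolynomial (Fin n) ℝ)) ^ m) P) =
      ((S : Module.End ℝ (PS n)) ^ m) (MvPolynomial.aeval y P) := by
    intro m
    induction m with
    | zero => intro P; rfl
    | succ m ih =>
      intro P
      rw [pow_succ, pow_succ, Module.End.mul_apply, Module.End.mul_apply, ih, Derivation.coeFn_coe,
        Derivation.coeFn_coe, apply_aeval_eq_aeval_linDer hSy]
  have hq' : ∀ (q : ℝ[X]) (P : MvPolynomial (Fin n) ℝ), MvPolynomial.aeval y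
      (aeval (linDer L : Module.End ℝ (MvPolynomial (Fin n) ℝ)) q P) =
      aeval (S : Module.End ℝ (PS n)) q (MvPolynomial.aeval y P) := by
    intro q P
    rw [aeval_eq_sum_range, aeval_eq_sum_range]
    simp only [LinearMap.sum_apply, LinearMap.smul_apply, map_sum, map_smul, hpow]
  have hhom : ∀ (q : ℝ[X]) (P : MvPolynomial (Fin n) ℝ), P.IsHomogeneous d →
      (aeval (linDer L : Module.End ℝ (MvPolynomial (Fin n) ℝ)) q P).IsHomogeneous d := by
    intro q P hP
    exact aeval_mem (J := MvPolynomial.homogeneousSubmodule (Fin n) ℝ d)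
      (fun v hv => isHomogeneous_linDer L hv) q hP
  have hzero : ∀ P : MvPolynomial (Fin n) ℝ, P.IsHomogeneous d →
      aeval (linDer L : Module.End ℝ (MvPolynomial (Fin n) ℝ)) q P = 0 := by
    intro P hP
    refine eq_zero_of_coe_mem_ordIdeal (hhom q P hP) ?_
    have h1 := sub_mem (hqS (MvPolynomial.aeval y P)) (aeval_sub_coe_mem hy (hhom q P hP))
    rwa [← hq', sub_sub_cancel] at h1
  have h := congrArg (fun p => aeval (linDer L : Module.End ℝ (MvPolynomial (Fin n) ℝ)) p P) hr
  simp only [map_sub, map_mul, aeval_X, LinearMap.sub_apply, pow_two,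
    Module.End.mul_apply] at h
  rw [hzero _ (hhom c P hP), sub_eq_zero] at h
  exact h

theorem homogeneousComponent_mul_of_isHomogeneous {δ : ℕ} (a : MvPolynomial (Fin n) ℝ)
    {p : MvPolynomial (Fin n) ℝ} (hp : p.IsHomogeneous δ) (d : ℕ) :
    MvPolynomial.homogeneousComponent d (a * p) =
      if δ ≤ d then MvPolynomial.homogeneousComponent (d - δ) a * p else 0 := by
  have hi : ∀ i, MvPolynomial.homogeneousComponent d
      (MvPolynomial.homogeneousComponent i a * p) =
      if d = i + δ then MvPolynomial.homogeneousComponent i a * p else 0 := fun i =>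
    MvPolynomial.homogeneousComponent_of_mem
      ((MvPolynomial.homogeneousComponent_isHomogeneous i a).mul hp)
  conv_lhs => rw [← MvPolynomial.sum_homogeneousComponent a, Finset.sum_mul, map_sum]
  simp only [hi]
  split_ifs with h
  · rw [Finset.sum_eq_single (d - δ)]
    · rw [if_pos (by omega)]
    · intro i _ hne
      rw [if_neg (by omega)]
    · intro hmem
      rw [if_pos (by omega), MvPolynomial.homogeneousComponent_eq_zero, zero_mul]
      rw [Finset.mem_range] at hmem
      omega
  · exact Finset.sum_eq_zero fun i _ => if_neg (by omega)

/-- **Hilbert's finiteness theorem** for the polynomial first integrals of a semisimple linear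
vector field: finitely many homogeneous first integrals `p` of positive degree generate them all.
The Reynolds operator of Hilbert's argument is the projection to the kernel of the vector field
along its range. The bound on the support of `Q` lets power series in `p` be formed degree by
degree. -/
theorem exists_invariant_generators {L : Matrix (Fin n) (Fin n) ℝ}
    (hL : ∀ d, ∃ r : ℝ[X], ∀ P : MvPolynomial (Fin n) ℝ, P.IsHomogeneous d →
      linDer L P = linDer L (linDer L
        (aeval (linDer L : Module.End ℝ (MvPolynomial (Fin n) ℝ)) r P))) :
    ∃ (m : ℕ) (p : Fin m → MvPolynomial (Fin n) ℝ) (M : ℕ),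
      (∀ j, MvPolynomial.constantCoeff (p j) = 0) ∧ (∀ j, linDer L (p j) = 0) ∧
      ∀ (d : ℕ) (P : MvPolynomial (Fin n) ℝ), P.IsHomogeneous d → linDer L P = 0 →
        ∃ Q : MvPolynomial (Fin m) ℝ, MvPolynomial.aeval p Q = P ∧
          ∀ β, Q.coeff β ≠ 0 → d ≤ M * β.degree := by
  let G : Set (MvPolynomial (Fin n) ℝ) := {P | ∃ d, 1 ≤ d ∧ P.IsHomogeneous d ∧ linDer L P = 0}
  have hfg : (Ideal.span G).FG := IsNoetherian.noetherian _
  obtain ⟨t, htG, ht⟩ := (Submodule.fg_span_iff_fg_span_finset_subset G).1 hfg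
  let p : Fin t.card → MvPolynomial (Fin n) ℝ := fun j => (t.equivFin.symm j).1
  have hpG : ∀ j, p j ∈ G := fun j => htG (t.equivFin.symm j).2
  have hrange : Set.range p = (t : Set (MvPolynomial (Fin n) ℝ)) := by
    ext P
    constructor
    · rintro ⟨j, rfl⟩
      exact (t.equivFin.symm j).2
    · intro hP
      exact ⟨t.equivFin ⟨P, hP⟩, by simp [p]⟩
  choose δ hδ1 hδ hδL using hpG
  -- the projection to the kernel along the range, in degree `d`
  have hsplit : ∀ (d : ℕ) (a : MvPolynomial (Fin n) ℝ), a.IsHomogeneous d →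
      ∃ a₀ b : MvPolynomial (Fin n) ℝ, a = a₀ + linDer L b ∧ a₀.IsHomogeneous d ∧
        b.IsHomogeneous d ∧ linDer L a₀ = 0 := by
    intro d a ha
    obtain ⟨r, hr⟩ := hL d
    have hb : (aeval (linDer L : Module.End ℝ (MvPolynomial (Fin n) ℝ)) r a).IsHomogeneous d :=
      aeval_mem (J := MvPolynomial.homogeneousSubmodule (Fin n) ℝ d)
        (fun v hv => isHomogeneous_linDer L hv) r ha
    refine ⟨a - linDer L (aeval (linDer L : Module.End ℝ (MvPolynomial (Fin n) ℝ)) r a), _,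
      (sub_add_cancel _ _).symm, ha.sub (isHomogeneous_linDer L hb), hb, ?_⟩
    rw [map_sub, ← hr a ha, sub_self]
  have hker : ∀ (d : ℕ) (b : MvPolynomial (Fin n) ℝ), b.IsHomogeneous d →
      linDer L (linDer L b) = 0 → linDer L b = 0 := by
    intro d b hb h
    obtain ⟨r, hr⟩ := hL d
    have e := congrArg (fun p => aeval (linDer L : Module.End ℝ (MvPolynomial (Fin n) ℝ)) p b)
      (show (X * (X * r) : ℝ[X]) = r * (X * X) by ring)
    simp only [map_mul, aeval_X, Module.End.mul_apply, Derivation.coeFn_coe, h, map_zero] at e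
    rw [hr b hb, e]
  refine ⟨t.card, p, ∑ j, δ j, fun j => ?_, hδL, fun d => ?_⟩
  · rw [MvPolynomial.constantCoeff_eq]
    refine (hδ j).coeff_eq_zero ?_
    rw [map_zero]
    exact (Nat.lt_of_lt_of_le one_pos (hδ1 j)).ne
  induction d using Nat.strong_induction_on with
  | _ d ih =>
  intro P hP hPL
  rcases Nat.eq_zero_or_pos d with rfl | hd
  · rw [← MvPolynomial.totalDegree_zero_iff_isHomogeneous,
      MvPolynomial.totalDegree_eq_zero_iff_eq_C] at hP
    refine ⟨MvPolynomial.C (P.coeff 0), ?_, fun β _ => Nat.zero_le _⟩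
    rw [MvPolynomial.aeval_C, MvPolynomial.algebraMap_eq, ← hP]
  have hPs : P ∈ Ideal.span (Set.range p) := by
    rw [hrange]
    have : P ∈ Ideal.span G := Ideal.subset_span ⟨d, hd, hP, hPL⟩
    rwa [Ideal.span, ht] at this
  obtain ⟨a, ha⟩ := Ideal.mem_span_range_iff_exists_fun.1 hPs
  have hj : ∀ j, ∃ a₀ b : MvPolynomial (Fin n) ℝ,
      MvPolynomial.homogeneousComponent d (a j * p j) = (a₀ + linDer L b) * p j ∧
      (b * p j).IsHomogeneous d ∧ linDer L a₀ = 0 ∧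
      ∃ Q : MvPolynomial (Fin t.card) ℝ, MvPolynomial.aeval p Q = a₀ ∧
        ∀ β, Q.coeff β ≠ 0 → d ≤ (∑ j, δ j) * β.degree + δ j := by
    intro j
    rw [homogeneousComponent_mul_of_isHomogeneous _ (hδ j)]
    split_ifs with h
    · obtain ⟨a₀, b, h1, h2, h3, h4⟩ := hsplit (d - δ j) _
        (MvPolynomial.homogeneousComponent_isHomogeneous (d - δ j) (a j))
      obtain ⟨Q, hQ, hQ'⟩ := ih (d - δ j) (by have := hδ1 j; omega) a₀ h2 h4
      refine ⟨a₀, b, by rw [h1], ?_, h4, Q, hQ, fun β hβ => ?_⟩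
      · have := h3.mul (hδ j)
        rwa [Nat.sub_add_cancel h] at this
      · have := hQ' β hβ
        omega
    · refine ⟨0, 0, by simp, ?_, map_zero _, 0, by simp,
        fun β hβ => absurd (MvPolynomial.coeff_zero β) hβ⟩
      rw [zero_mul]
      exact MvPolynomial.isHomogeneous_zero _ _ _
  choose a₀ b hab hbp ha₀L Q hQ hQ' using hj
  have hPsum : P = ∑ j, (a₀ j + linDer L (b j)) * p j := by
    have := congrArg (MvPolynomial.homogeneousComponent d) ha
    rw [map_sum, MvPolynomial.homogeneousComponent_eq_self hP] at this
    rw [← this]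
    exact Finset.sum_congr rfl fun j _ => hab j
  have hPL' : P = ∑ j, a₀ j * p j + linDer L (∑ j, b j * p j) := by
    rw [hPsum, map_sum, ← Finset.sum_add_distrib]
    refine Finset.sum_congr rfl fun j _ => ?_
    rw [Derivation.leibniz, hδL, smul_zero, zero_add, smul_eq_mul]
    ring
  have ha₀ : linDer L (∑ j, a₀ j * p j) = 0 := by
    rw [map_sum]
    refine Finset.sum_eq_zero fun j _ => ?_
    rw [Derivation.leibniz, hδL, ha₀L, smul_zero, smul_zero, zero_add]
  have hzero : linDer L (∑ j, b j * p j) = 0 := by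
    refine hker d _ (MvPolynomial.IsHomogeneous.sum _ _ _ fun j _ => hbp j) ?_
    have := congrArg (linDer L) hPL'
    rw [hPL, map_add, ha₀, zero_add] at this
    exact this.symm
  rw [hzero, add_zero] at hPL'
  refine ⟨∑ j, Q j * MvPolynomial.X j, ?_, fun β hβ => ?_⟩
  · rw [map_sum, hPL']
    refine Finset.sum_congr rfl fun j _ => ?_
    rw [map_mul, MvPolynomial.aeval_X, hQ]
  · rw [MvPolynomial.coeff_sum] at hβ
    obtain ⟨j, -, hj⟩ := Finset.exists_ne_zero_of_sum_ne_zero hβ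
    rw [MvPolynomial.coeff_mul_X'] at hj
    split_ifs at hj with hjs
    · have h1 := hQ' j _ hj
      have hle : Finsupp.single j 1 ≤ β := by
        rw [Finsupp.single_le_iff]
        exact Nat.one_le_iff_ne_zero.2 (Finsupp.mem_support_iff.1 hjs)
      have h2 := congrArg Finsupp.degree (tsub_add_cancel_of_le hle)
      rw [map_add, Finsupp.degree_single] at h2
      have h3 : δ j ≤ ∑ j, δ j :=
        Finset.single_le_sum (fun _ _ => Nat.zero_le _) (Finset.mem_univ j)
      rw [← h2, mul_add, mul_one]
      omega
    · exact absurd rfl hj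

open Topology

/-! ### Jets of germs of smooth functions -/

theorem partialDeriv_contDiffAt {f : E n → ℝ} {x : E n} (hf : ContDiffAt ℝ ∞ f x) (i : Fin n) :
    ContDiffAt ℝ ∞ (partialDeriv i f) x :=
  (hf.fderiv_right (m := ∞) (by simp)).clm_apply contDiffAt_const

theorem partialDeriv_congr {f g : E n → ℝ} {x : E n} (h : f =ᶠ[𝓝 x] g) (i : Fin n) :
    partialDeriv i f =ᶠ[𝓝 x] partialDeriv i g := by
  filter_upwards [h.fderiv (𝕜 := ℝ)] with y hy
  simp only [partialDeriv, hy]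

theorem iterate_partialDeriv_congr {f g : E n → ℝ} {x : E n} (h : f =ᶠ[𝓝 x] g) (i : Fin n)
    (m : ℕ) : (partialDeriv i)^[m] f =ᶠ[𝓝 x] (partialDeriv i)^[m] g := by
  induction m generalizing f g with
  | zero => exact h
  | succ m ih =>
    rw [Function.iterate_succ_apply, Function.iterate_succ_apply]
    exact ih (partialDeriv_congr h i)

theorem iterate_partialDeriv_contDiffAt {f : E n → ℝ} {x : E n} (hf : ContDiffAt ℝ ∞ f x)
    (i : Fin n) (m : ℕ) : ContDiffAt ℝ ∞ ((partialDeriv i)^[m] f) x := by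
  induction m generalizing f with
  | zero => exact hf
  | succ m ih =>
    rw [Function.iterate_succ_apply]
    exact ih (partialDeriv_contDiffAt hf i)

/-- Partial derivatives of smooth germs commute. -/
theorem partialDeriv_comm {f : E n → ℝ} {x : E n} (hf : ContDiffAt ℝ ∞ f x) (i j : Fin n) :
    partialDeriv i (partialDeriv j f) =ᶠ[𝓝 x] partialDeriv j (partialDeriv i f) := by
  have h2 : ContDiffAt ℝ 2 f x := by exact_mod_cast contDiffAt_infty.1 hf 2
  filter_upwards [h2.eventually (by simp)] with y hy
  have hd : DifferentiableAt ℝ (fderiv ℝ f) y :=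
    (hy.fderiv_right (m := 1) (by norm_num)).differentiableAt (by norm_num)
  have key : ∀ i j : Fin n, partialDeriv i (partialDeriv j f) y =
      fderiv ℝ (fderiv ℝ f) y (EuclideanSpace.single i 1) (EuclideanSpace.single j 1) := by
    intro i j
    have e : partialDeriv j f = fun y => fderiv ℝ f y (EuclideanSpace.single j 1) := rfl
    rw [e, partialDeriv, fderiv_clm_apply hd (differentiableAt_const _)]
    simp
  rw [key, key]
  exact (hy.isSymmSndFDerivAt (by simp)).eq _ _

theorem partialDeriv_iterate_comm {f : E n → ℝ} {x : E n} (hf : ContDiffAt ℝ ∞ f x) (i j : Fin n)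
    (m : ℕ) : partialDeriv i ((partialDeriv j)^[m] f) =ᶠ[𝓝 x]
      (partialDeriv j)^[m] (partialDeriv i f) := by
  induction m generalizing f with
  | zero => exact Filter.EventuallyEq.rfl
  | succ m ih =>
    rw [Function.iterate_succ_apply, Function.iterate_succ_apply]
    exact (ih (partialDeriv_contDiffAt hf j)).trans
      (iterate_partialDeriv_congr (partialDeriv_comm hf i j) j m)

section Fold

/-- The iterated partial derivative along the indices in a list. -/
noncomputable def foldPartialDeriv (l : List (Fin n)) (α : Fin n →₀ ℕ) (f : E n → ℝ) : E n → ℝ :=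
  l.foldr (fun i g => (partialDeriv i)^[α i] g) f

theorem foldPartialDeriv_cons (j : Fin n) (l : List (Fin n)) (α : Fin n →₀ ℕ) (f : E n → ℝ) :
    foldPartialDeriv (j :: l) α f = (partialDeriv j)^[α j] (foldPartialDeriv l α f) := rfl

theorem foldPartialDeriv_congr {f g : E n → ℝ} {x : E n} (h : f =ᶠ[𝓝 x] g) (l : List (Fin n))
    (α : Fin n →₀ ℕ) : foldPartialDeriv l α f =ᶠ[𝓝 x] foldPartialDeriv l α g := by
  induction l with
  | nil => exact h
  | cons j l ih => exact iterate_partialDeriv_congr ih j _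

theorem foldPartialDeriv_contDiffAt {f : E n → ℝ} {x : E n} (hf : ContDiffAt ℝ ∞ f x)
    (l : List (Fin n)) (α : Fin n →₀ ℕ) : ContDiffAt ℝ ∞ (foldPartialDeriv l α f) x := by
  induction l with
  | nil => exact hf
  | cons j l ih => exact iterate_partialDeriv_contDiffAt ih j _

theorem partialDeriv_foldPartialDeriv {f : E n → ℝ} {x : E n} (hf : ContDiffAt ℝ ∞ f x)
    (i : Fin n) (l : List (Fin n)) (α : Fin n →₀ ℕ) :
    partialDeriv i (foldPartialDeriv l α f) =ᶠ[𝓝 x] foldPartialDeriv l α (partialDeriv i f) := by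
  induction l with
  | nil => exact Filter.EventuallyEq.rfl
  | cons j l ih =>
    rw [foldPartialDeriv_cons, foldPartialDeriv_cons]
    exact (partialDeriv_iterate_comm (foldPartialDeriv_contDiffAt hf l α) i j _).trans
      (iterate_partialDeriv_congr ih j _)

theorem foldPartialDeriv_add_single_of_notMem {i : Fin n} {l : List (Fin n)} (hi : i ∉ l)
    (α : Fin n →₀ ℕ) (f : E n → ℝ) :
    foldPartialDeriv l (α + Finsupp.single i 1) f = foldPartialDeriv l α f := by
  induction l with
  | nil => rfl
  | cons j l ih =>
    rw [List.mem_cons, not_or] at hi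
    rw [foldPartialDeriv_cons, foldPartialDeriv_cons, ih hi.2]
    have : (α + Finsupp.single i 1 : Fin n →₀ ℕ) j = α j := by
      rw [Finsupp.add_apply, Finsupp.single_eq_of_ne (Ne.symm hi.1), add_zero]
    rw [this]

theorem foldPartialDeriv_add_single {f : E n → ℝ} {x : E n} (hf : ContDiffAt ℝ ∞ f x) {i : Fin n}
    {l : List (Fin n)} (hl : l.Nodup) (hi : i ∈ l) (α : Fin n →₀ ℕ) :
    foldPartialDeriv l (α + Finsupp.single i 1) f =ᶠ[𝓝 x]
      foldPartialDeriv l α (partialDeriv i f) := by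
  induction l with
  | nil => simp at hi
  | cons j l ih =>
    rw [List.nodup_cons] at hl
    rw [foldPartialDeriv_cons, foldPartialDeriv_cons]
    by_cases hij : i = j
    · subst hij
      rw [foldPartialDeriv_add_single_of_notMem hl.1, Finsupp.add_apply, Finsupp.single_eq_same,
        Function.iterate_succ_apply]
      exact iterate_partialDeriv_congr (partialDeriv_foldPartialDeriv hf i l α) _ _
    · have hi' : i ∈ l := (List.mem_cons.1 hi).resolve_left hij
      have : (α + Finsupp.single i 1 : Fin n →₀ ℕ) j = α j := by
        rw [Finsupp.add_apply, Finsupp.single_eq_of_ne (Ne.symm hij), add_zero]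
      rw [this]
      exact iterate_partialDeriv_congr (ih hl.2 hi') _ _

end Fold

theorem coeff_jet (f : E n → ℝ) (α : Fin n →₀ ℕ) : MvPowerSeries.coeff α (jet f) =
    foldPartialDeriv (List.finRange n) α f 0 / ((∏ i, (α i).factorial : ℕ) : ℝ) := rfl

theorem jet_congr {f g : E n → ℝ} (h : f =ᶠ[𝓝 0] g) : jet f = jet g := by
  ext α
  rw [coeff_jet, coeff_jet, (foldPartialDeriv_congr h _ α).eq_of_nhds]

theorem constantCoeff_jet (f : E n → ℝ) : MvPowerSeries.constantCoeff (jet f) = f 0 := by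
  rw [← MvPowerSeries.coeff_zero_eq_constantCoeff_apply, coeff_jet]
  have : ∀ l : List (Fin n), foldPartialDeriv l 0 f = f := by
    intro l
    induction l with
    | nil => rfl
    | cons j l ih => rw [foldPartialDeriv_cons, ih]; rfl
  rw [this]
  simp

/-- Taking jets commutes with partial differentiation. -/
theorem pderiv_jet {f : E n → ℝ} (hf : ContDiffAt ℝ ∞ f 0) (i : Fin n) :
    MvPowerSeries.pderiv ℝ i (jet f) = jet (partialDeriv i f) := by
  ext α
  rw [MvPowerSeries.coeff_pderiv, coeff_jet, coeff_jet,
    (foldPartialDeriv_add_single hf (List.nodup_finRange n) (List.mem_finRange i) α).eq_of_nhds]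
  have h1 : ∏ j, ((α + Finsupp.single i 1 : Fin n →₀ ℕ) j).factorial =
      (α i + 1) * ∏ j, (α j).factorial := by
    rw [← Finset.mul_prod_erase _ _ (Finset.mem_univ i),
      ← Finset.mul_prod_erase Finset.univ (fun j => (α j).factorial) (Finset.mem_univ i),
      ← mul_assoc, ← Nat.factorial_succ]
    congr 1
    · simp
    · refine Finset.prod_congr rfl fun j hj => ?_
      rw [Finsupp.add_apply, Finsupp.single_eq_of_ne (Finset.ne_of_mem_erase hj), add_zero]
  have h2 : ((∏ j, (α j).factorial : ℕ) : ℝ) ≠ 0 := by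
    exact_mod_cast (Finset.prod_pos fun j _ => Nat.factorial_pos (α j)).ne'
  rw [h1, Nat.cast_mul]
  push_cast at h2 ⊢
  field_simp

theorem partialDeriv_const (c : ℝ) (i : Fin n) :
    partialDeriv i (fun _ : E n => c) = fun _ => 0 := by
  funext x
  simp [partialDeriv]

theorem jet_zero : jet (fun _ : E n => (0 : ℝ)) = 0 := by
  refine eq_zero_of_forall_mem_ordIdeal fun k => ?_
  induction k with
  | zero => exact mem_ordIdeal_zero _
  | succ k ih =>
    refine mem_ordIdeal_succ.2 ⟨constantCoeff_jet _, fun i => ?_⟩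
    rw [pderiv_jet contDiffAt_const, partialDeriv_const]
    exact ih

theorem jet_const (c : ℝ) : jet (fun _ : E n => c) = MvPowerSeries.C c := by
  refine MvPowerSeries.pderiv.ext (fun i => ?_) ?_
  · rw [pderiv_jet contDiffAt_const, partialDeriv_const, jet_zero, MvPowerSeries.pderiv_C]
  · rw [constantCoeff_jet, MvPowerSeries.constantCoeff_C]

theorem partialDeriv_add {f g : E n → ℝ} {x : E n} (hf : ContDiffAt ℝ ∞ f x)
    (hg : ContDiffAt ℝ ∞ g x) (i : Fin n) : partialDeriv i (fun y => f y + g y) =ᶠ[𝓝 x]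
      fun y => partialDeriv i f y + partialDeriv i g y := by
  have hf1 : ContDiffAt ℝ 1 f x := hf.of_le (by exact_mod_cast le_top)
  have hg1 : ContDiffAt ℝ 1 g x := hg.of_le (by exact_mod_cast le_top)
  filter_upwards [hf1.eventually (by simp), hg1.eventually (by simp)] with y h1 h2
  simp only [partialDeriv]
  rw [fderiv_fun_add (h1.differentiableAt (by simp)) (h2.differentiableAt (by simp))]
  rfl

theorem partialDeriv_mul {f g : E n → ℝ} {x : E n} (hf : ContDiffAt ℝ ∞ f x)
    (hg : ContDiffAt ℝ ∞ g x) (i : Fin n) : partialDeriv i (fun y => f y * g y) =ᶠ[𝓝 x]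
      fun y => f y * partialDeriv i g y + g y * partialDeriv i f y := by
  have hf1 : ContDiffAt ℝ 1 f x := hf.of_le (by exact_mod_cast le_top)
  have hg1 : ContDiffAt ℝ 1 g x := hg.of_le (by exact_mod_cast le_top)
  filter_upwards [hf1.eventually (by simp), hg1.eventually (by simp)] with y h1 h2
  simp only [partialDeriv]
  rw [fderiv_fun_mul (h1.differentiableAt (by simp)) (h2.differentiableAt (by simp))]
  simp

theorem jet_add {f g : E n → ℝ} (hf : ContDiffAt ℝ ∞ f 0) (hg : ContDiffAt ℝ ∞ g 0) :
    jet (fun y => f y + g y) = jet f + jet g := by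
  rw [← sub_eq_zero]
  refine eq_zero_of_forall_mem_ordIdeal fun k => ?_
  induction k generalizing f g with
  | zero => exact mem_ordIdeal_zero _
  | succ k ih =>
    refine mem_ordIdeal_succ.2 ⟨by simp [constantCoeff_jet], fun i => ?_⟩
    rw [map_sub, map_add, pderiv_jet (hf.add hg), pderiv_jet hf, pderiv_jet hg,
      jet_congr (partialDeriv_add hf hg i)]
    exact ih (partialDeriv_contDiffAt hf i) (partialDeriv_contDiffAt hg i)

theorem jet_mul {f g : E n → ℝ} (hf : ContDiffAt ℝ ∞ f 0) (hg : ContDiffAt ℝ ∞ g 0) :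
    jet (fun y => f y * g y) = jet f * jet g := by
  rw [← sub_eq_zero]
  refine eq_zero_of_forall_mem_ordIdeal fun k => ?_
  induction k generalizing f g with
  | zero => exact mem_ordIdeal_zero _
  | succ k ih =>
    refine mem_ordIdeal_succ.2 ⟨by simp [constantCoeff_jet], fun i => ?_⟩
    have hf' := partialDeriv_contDiffAt hf i
    have hg' := partialDeriv_contDiffAt hg i
    rw [map_sub, Derivation.leibniz, pderiv_jet (hf.mul hg), pderiv_jet hf, pderiv_jet hg,
      jet_congr (partialDeriv_mul hf hg i), jet_add (hf.mul hg') (hg.mul hf')]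
    have := add_mem (ih hf hg') (ih hg hf')
    convert this using 1
    simp only [smul_eq_mul]
    ring

theorem jet_sub {f g : E n → ℝ} (hf : ContDiffAt ℝ ∞ f 0) (hg : ContDiffAt ℝ ∞ g 0) :
    jet (fun y => f y - g y) = jet f - jet g := by
  have := jet_add (hf.sub hg) hg
  simp only [sub_add_cancel] at this
  rw [this, add_sub_cancel_right]

theorem jet_sum {ι : Type*} (s : Finset ι) {f : ι → E n → ℝ}
    (hf : ∀ i ∈ s, ContDiffAt ℝ ∞ (f i) 0) :
    jet (fun y => ∑ i ∈ s, f i y) = ∑ i ∈ s, jet (f i) := by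
  classical
  induction s using Finset.induction_on with
  | empty => simpa using jet_zero
  | insert a s ha ih =>
    simp only [Finset.sum_insert ha]
    rw [jet_add (hf a (Finset.mem_insert_self a s))
      (ContDiffAt.sum fun i hi => hf i (Finset.mem_insert_of_mem hi)),
      ih fun i hi => hf i (Finset.mem_insert_of_mem hi)]

theorem contDiff_coord (i : Fin n) : ContDiff ℝ ∞ fun x : E n => x i :=
  (EuclideanSpace.proj (𝕜 := ℝ) i).contDiff

theorem jet_coord (i : Fin n) : jet (fun x : E n => x i) = MvPowerSeries.X i := by
  have hp : ∀ j, partialDeriv j (fun x : E n => x i) = fun _ => if i = j then 1 else 0 := by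
    intro j
    funext x
    have : HasFDerivAt (fun x : E n => x i) (EuclideanSpace.proj (𝕜 := ℝ) i) x :=
      (EuclideanSpace.proj (𝕜 := ℝ) i).hasFDerivAt
    simp only [partialDeriv]
    rw [this.fderiv]
    simp
  refine MvPowerSeries.pderiv.ext (fun j => ?_) ?_
  · rw [pderiv_jet (contDiff_coord i).contDiffAt, hp, jet_const, MvPowerSeries.pderiv_X]
    by_cases h : i = j
    · subst h; simp
    · simp [h]
  · rw [constantCoeff_jet, MvPowerSeries.constantCoeff_X]
    rfl

/-- The jet of a polynomial expression in smooth functions. -/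
theorem jet_eval {m : ℕ} {u : E n → Fin m → ℝ} (hu : ∀ j, ContDiffAt ℝ ∞ (fun x => u x j) 0)
    (P : MvPolynomial (Fin m) ℝ) : ContDiffAt ℝ ∞ (fun x => MvPolynomial.eval (u x) P) 0 ∧
      jet (fun x => MvPolynomial.eval (u x) P) =
        MvPolynomial.aeval (fun j => jet fun x => u x j) P := by
  induction P using MvPolynomial.induction_on with
  | C a =>
    simp only [MvPolynomial.eval_C, MvPolynomial.aeval_C]
    exact ⟨contDiffAt_const, jet_const a⟩
  | add p q hp hq =>
    simp only [map_add]
    exact ⟨hp.1.add hq.1, by rw [jet_add hp.1 hq.1, hp.2, hq.2]⟩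
  | mul_X p j hp =>
    simp only [map_mul, MvPolynomial.eval_X, MvPolynomial.aeval_X]
    exact ⟨hp.1.mul (hu j), by rw [jet_mul hp.1 (hu j), hp.2]⟩

theorem eq_sum_single (v : E n) : v = ∑ j, v j • EuclideanSpace.single j (1 : ℝ) := by
  ext i
  simp [Finset.sum_apply, Pi.single_apply]

theorem fderiv_apply_eq_sum (f : E n → ℝ) (x v : E n) :
    fderiv ℝ f x v = ∑ j, v j * partialDeriv j f x := by
  conv_lhs => rw [eq_sum_single v]
  rw [map_sum]
  exact Finset.sum_congr rfl fun j _ => by rw [map_smul, smul_eq_mul]; rfl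

theorem coeff_single_jet {f : E n → ℝ} (hf : ContDiffAt ℝ ∞ f 0) (j : Fin n) :
    MvPowerSeries.coeff (Finsupp.single j 1) (jet f) = partialDeriv j f 0 := by
  have h1 := MvPowerSeries.coeff_pderiv (i := j) (jet f) 0
  rw [pderiv_jet hf, MvPowerSeries.coeff_zero_eq_constantCoeff_apply, constantCoeff_jet] at h1
  simpa using h1.symm

/-- The jet of the derivative of `f` along a vector field `X`. -/
theorem jet_fderiv_apply {f : E n → ℝ} {X : E n → E n} (hf : ContDiffAt ℝ ∞ f 0)
    (hX : ContDiffAt ℝ ∞ X 0) : jet (fun x => fderiv ℝ f x (X x)) =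
      ∑ j, jet (fun x => X x j) * MvPowerSeries.pderiv ℝ j (jet f) := by
  have hXj : ∀ j, ContDiffAt ℝ ∞ (fun x => X x j) 0 := fun j =>
    (contDiff_coord j).contDiffAt.comp 0 hX
  simp only [fderiv_apply_eq_sum]
  rw [jet_sum _ fun j _ => (hXj j).mul (partialDeriv_contDiffAt hf j)]
  refine Finset.sum_congr rfl fun j _ => ?_
  rw [jet_mul (hXj j) (partialDeriv_contDiffAt hf j), pderiv_jet hf]

/-- Composition with a smooth map fixing the origin does not lower the order of vanishing. -/
theorem jet_comp_mem {m : ℕ} {h : E m → ℝ} {p : E n → E m} (hh : ContDiffAt ℝ ∞ h 0)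
    (hp : ContDiffAt ℝ ∞ p 0) (hp0 : p 0 = 0) {k : ℕ} (hk : jet h ∈ ordIdeal m k) :
    jet (fun x => h (p x)) ∈ ordIdeal n k := by
  induction k generalizing h with
  | zero => exact mem_ordIdeal_zero _
  | succ k ih =>
    rw [mem_ordIdeal_succ, constantCoeff_jet] at hk
    have hcomp : ∀ {g : E m → ℝ}, ContDiffAt ℝ ∞ g 0 → ContDiffAt ℝ ∞ (fun x => g (p x)) 0 :=
      fun hg => ContDiffAt.comp 0 (by rwa [hp0]) hp
    have hpj : ∀ j, ContDiffAt ℝ ∞ (fun x => p x j) 0 := fun j =>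
      (contDiff_coord j).contDiffAt.comp 0 hp
    refine mem_ordIdeal_succ.2 ⟨by rw [constantCoeff_jet, hp0, hk.1], fun i => ?_⟩
    have e : partialDeriv i (fun x => h (p x)) =ᶠ[𝓝 0]
        fun x => ∑ j, partialDeriv j h (p x) * partialDeriv i (fun x => p x j) x := by
      have h1 : ContDiffAt ℝ 1 h (p 0) := by
        rw [hp0]; exact hh.of_le (by exact_mod_cast le_top)
      have h2 : ContDiffAt ℝ 1 p 0 := hp.of_le (by exact_mod_cast le_top)
      filter_upwards [hp.continuousAt.eventually (h1.eventually (by simp)),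
        h2.eventually (by simp)] with x hx1 hx2
      have d1 := hx1.differentiableAt (by simp)
      have d2 := hx2.differentiableAt (by simp)
      have e1 : fderiv ℝ (fun x => h (p x)) x = (fderiv ℝ h (p x)).comp (fderiv ℝ p x) :=
        fderiv_comp x d1 d2
      simp only [partialDeriv]
      rw [e1, ContinuousLinearMap.comp_apply, fderiv_apply_eq_sum]
      refine Finset.sum_congr rfl fun j _ => ?_
      have e2 : fderiv ℝ (fun x => p x j) x =
          (EuclideanSpace.proj (𝕜 := ℝ) j).comp (fderiv ℝ p x) :=
        ((EuclideanSpace.proj (𝕜 := ℝ) j).hasFDerivAt.comp x d2.hasFDerivAt).fderiv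
      rw [e2, mul_comm]
      rfl
    rw [pderiv_jet (hcomp hh), jet_congr e, jet_sum _ fun j _ =>
      (hcomp (partialDeriv_contDiffAt hh j)).mul (partialDeriv_contDiffAt (hpj j) i)]
    refine Submodule.sum_mem _ fun j _ => ?_
    rw [jet_mul (hcomp (partialDeriv_contDiffAt hh j)) (partialDeriv_contDiffAt (hpj j) i)]
    refine Ideal.mul_mem_right _ _ (ih (partialDeriv_contDiffAt hh j) ?_)
    rw [← pderiv_jet hh]
    exact hk.2 j

/-! ### Flatness and Borel's lemma -/

theorem iteratedFDeriv_eq_zero_of_components {ι V : Type*} [Fintype ι] [NormedAddCommGroup V]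
    [NormedSpace ℝ V] {f : ι → E n → ℝ} {k : ℕ} (hf : ∀ j, ContDiffAt ℝ ∞ (f j) 0)
    (h : ∀ j, iteratedFDeriv ℝ k (f j) 0 = 0) (v : ι → V) :
    iteratedFDeriv ℝ k (fun x => ∑ j, f j x • v j) 0 = 0 := by
  have h1 : ∀ j, (fun x => f j x • v j) = ContinuousLinearMap.toSpanSingleton ℝ (v j) ∘ f j :=
    fun j => rfl
  have hk : (k : WithTop ℕ∞) ≤ ∞ := by exact_mod_cast le_top
  rw [iteratedFDeriv_fun_sum_apply (f := fun j x => f j x • v j)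
    fun j _ => ((hf j).smul contDiffAt_const).of_le hk]
  refine Finset.sum_eq_zero fun j _ => ?_
  rw [h1, ContinuousLinearMap.iteratedFDeriv_comp_left _ (hf j) hk, h j]
  ext
  simp

/-- If the jet of `f` has order greater than `k`, then the `k`-th derivative of `f` vanishes. -/
theorem iteratedFDeriv_eq_zero_of_jet_mem {k : ℕ} {f : E n → ℝ} (hf : ContDiffAt ℝ ∞ f 0)
    (h : jet f ∈ ordIdeal n (k + 1)) : iteratedFDeriv ℝ k f 0 = 0 := by
  induction k generalizing f with
  | zero =>
    have := (mem_ordIdeal_succ.1 h).1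
    rw [constantCoeff_jet] at this
    ext
    simp [this]
  | succ k ih =>
    have e : (fun y => fderiv ℝ f y) =
        fun y => ∑ j, partialDeriv j f y • (EuclideanSpace.proj (𝕜 := ℝ) j : E n →L[ℝ] ℝ) := by
      funext y
      ext v
      rw [fderiv_apply_eq_sum]
      simp [mul_comm]
    have h0 : ∀ j, iteratedFDeriv ℝ k (partialDeriv j f) 0 = 0 := fun j =>
      ih (partialDeriv_contDiffAt hf j) (by
        rw [← pderiv_jet hf]
        exact pderiv_mem_ordIdeal j h)
    rw [iteratedFDeriv_succ_eq_comp_right, Function.comp_apply, e,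
      iteratedFDeriv_eq_zero_of_components (fun j => partialDeriv_contDiffAt hf j) h0]
    exact LinearIsometryEquiv.map_zero _

/-- Conversely, if all derivatives of `f` of order less than `k` vanish, then the jet of `f` has
order at least `k`. -/
theorem jet_mem_of_iteratedFDeriv_eq_zero {k : ℕ} {f : E n → ℝ} (hf : ContDiffAt ℝ ∞ f 0)
    (h : ∀ i < k, iteratedFDeriv ℝ i f 0 = 0) : jet f ∈ ordIdeal n k := by
  induction k generalizing f with
  | zero => exact mem_ordIdeal_zero _
  | succ k ih =>
    refine mem_ordIdeal_succ.2 ⟨?_, fun j => ?_⟩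
    · have := congrArg (fun T => T 0) (h 0 (by omega))
      simpa [constantCoeff_jet] using this
    · rw [pderiv_jet hf]
      refine ih (partialDeriv_contDiffAt hf j) fun i hi => ?_
      have h1 := h (i + 1) (by omega)
      rw [iteratedFDeriv_succ_eq_comp_right, Function.comp_apply,
        LinearIsometryEquiv.map_eq_zero_iff] at h1
      have e : partialDeriv j f =
          ContinuousLinearMap.apply ℝ ℝ (EuclideanSpace.single j (1 : ℝ) : E n) ∘
            fun y => fderiv ℝ f y := rfl
      rw [e, ContinuousLinearMap.iteratedFDeriv_comp_left (n := ∞) _ (hf.fderiv_right (by simp))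
        (by exact_mod_cast le_top), h1]
      ext
      simp

/-- A vector field whose components have zero jets is flat. -/
theorem isFlat_of_jet_eq_zero {R : E n → E n} (hR : ∀ i, ContDiffAt ℝ ∞ (fun x => R x i) 0)
    (h : ∀ i, jet (fun x => R x i) = 0) : IsFlat R := by
  intro k
  have e : R = fun x => ∑ j, R x j • (EuclideanSpace.single j (1 : ℝ) : E n) := by
    funext x
    exact eq_sum_single (R x)
  rw [e]
  exact iteratedFDeriv_eq_zero_of_components hR (fun j =>
    iteratedFDeriv_eq_zero_of_jet_mem (hR j) (by rw [h j]; exact zero_mem _)) _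

/-- The derivatives of order less than `d` of `x ↦ s⁻ᵈ ψ(s x)` are uniformly small for large `s`:
the `k`-th one is of size `s ^ (k - d)`. -/
theorem exists_scale_bound {ψ : E n → ℝ} (hψ : ContDiff ℝ ∞ ψ) (hc : HasCompactSupport ψ) (d : ℕ)
    {ε : ℝ} (hε : 0 < ε) : ∃ s : ℝ, 1 ≤ s ∧ ∀ k < d, ∀ x,
      ‖iteratedFDeriv ℝ k (fun x => (s ^ d)⁻¹ * ψ (s • x)) x‖ ≤ ε := by
  have hb : ∀ k : ℕ, ∃ C : ℝ, ∀ x, ‖iteratedFDeriv ℝ k ψ x‖ ≤ C := fun k =>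
    (hψ.continuous_iteratedFDeriv (by exact_mod_cast le_top)).bounded_above_of_compact_support
      (hc.iteratedFDeriv k)
  choose C hC using hb
  have hC0 : ∀ k, 0 ≤ C k := fun k => (norm_nonneg _).trans (hC k 0)
  set B := ∑ k ∈ Finset.range d, C k with hB
  have hB0 : 0 ≤ B := Finset.sum_nonneg fun k _ => hC0 k
  have hs1 : 1 ≤ 1 + B / ε := by
    have := div_nonneg hB0 hε.le
    linarith
  set s := 1 + B / ε with hs
  have hs0 : 0 < s := by linarith
  refine ⟨s, hs1, fun k hk x => ?_⟩
  let g : E n →L[ℝ] E n := s • ContinuousLinearMap.id ℝ (E n)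
  have hg : ‖g‖ ≤ s := by
    refine (norm_smul_le s (ContinuousLinearMap.id ℝ (E n))).trans ?_
    rw [Real.norm_of_nonneg hs0.le]
    exact mul_le_of_le_one_right hs0.le ContinuousLinearMap.norm_id_le
  have hcomp : ContDiff ℝ ∞ (ψ ∘ g) := hψ.comp g.contDiff
  have e1 : (fun x => (s ^ d)⁻¹ * ψ (s • x)) = (s ^ d)⁻¹ • (ψ ∘ g) := rfl
  have hkt : (k : WithTop ℕ∞) ≤ ∞ := by exact_mod_cast le_top
  rw [e1, iteratedFDeriv_const_smul_apply (hcomp.contDiffAt.of_le hkt), norm_smul,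
    g.iteratedFDeriv_comp_right hψ x hkt]
  have h2 : ‖(iteratedFDeriv ℝ k ψ (g x)).compContinuousLinearMap fun _ => g‖ ≤ B * s ^ k := by
    refine (ContinuousMultilinearMap.norm_compContinuousLinearMap_le _ _).trans ?_
    rw [Finset.prod_const, Finset.card_univ, Fintype.card_fin]
    refine mul_le_mul ((hC k _).trans ?_) (pow_le_pow_left₀ (norm_nonneg _) hg k) (by positivity)
      hB0
    exact Finset.single_le_sum (fun i _ => hC0 i) (Finset.mem_range.2 hk)
  rw [Real.norm_of_nonneg (by positivity)]
  calc (s ^ d)⁻¹ * _ ≤ (s ^ d)⁻¹ * (B * s ^ k) := by gcongr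
    _ ≤ (s ^ (k + 1))⁻¹ * (B * s ^ k) := by
        gcongr
        exact hk
    _ = B / s := by
        rw [pow_succ]; field_simp
    _ ≤ ε := by
        rw [div_le_iff₀ hs0, hs, mul_add, mul_one, mul_div_cancel₀ _ hε.ne']
        linarith

/-- Termwise differentiation at the origin of a series of functions all of whose `i`-th derivatives
vanish there. -/
theorem iteratedFDeriv_tsum_eq_zero {ι : Type*} {F : ι → E n → ℝ} {v : ι → ℝ} {i : ℕ}
    (hF : ∀ α, ContDiff ℝ ∞ (F α)) (hv : Summable v)
    (hb : ∀ k ≤ i, ∀ α x, ‖iteratedFDeriv ℝ k (F α) x‖ ≤ v α)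
    (h0 : ∀ α, iteratedFDeriv ℝ i (F α) 0 = 0) :
    iteratedFDeriv ℝ i (fun x => ∑' α, F α x) 0 = 0 := by
  have hF' : ∀ α, ContDiff ℝ ((i : ℕ∞) : WithTop ℕ∞) (F α) := fun α =>
    (hF α).of_le (by exact_mod_cast le_top)
  rw [iteratedFDeriv_tsum_apply (v := fun _ => v) hF' (fun _ _ => hv)
    (fun k α x hk => hb k (by exact_mod_cast hk) α x) le_rfl]
  simp only [h0, tsum_zero]

/-- **Borel's lemma**: every formal power series is the jet of a smooth function, namely of the sum
of its monomials, multiplied by cut-off functions of rapidly shrinking support. -/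
theorem exists_contDiff_jet_eq (a : PS n) : ∃ f : E n → ℝ, ContDiff ℝ ∞ f ∧ jet f = a := by
  classical
  have : Encodable (Fin n →₀ ℕ) := Encodable.ofCountable _
  let χ : ContDiffBump (0 : E n) := ⟨1, 2, one_pos, one_lt_two⟩
  let mon : (Fin n →₀ ℕ) → E n → ℝ := fun α x =>
    MvPolynomial.eval (fun i => x i) (MvPolynomial.monomial α (MvPowerSeries.coeff α a))
  have hmon : ∀ α, ContDiff ℝ ∞ (mon α) := by
    intro α
    simp only [mon, MvPolynomial.eval_monomial, Finsupp.prod]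
    exact contDiff_const.mul (contDiff_prod fun i _ => (contDiff_coord i).pow _)
  have hmonhom : ∀ α (s : ℝ) x, mon α (s • x) = s ^ α.degree * mon α x := by
    intro α s x
    simp only [mon, MvPolynomial.eval_monomial, Finsupp.prod, PiLp.smul_apply, smul_eq_mul, mul_pow,
      Finset.prod_mul_distrib, Finset.prod_pow_eq_pow_sum, Finsupp.degree_apply]
    ring
  have hψ : ∀ α, ContDiff ℝ ∞ fun x => mon α x * χ x := fun α => (hmon α).mul χ.contDiff
  have hψc : ∀ α, HasCompactSupport fun x => mon α x * χ x := fun α =>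
    χ.hasCompactSupport.mul_left
  let ε : (Fin n →₀ ℕ) → ℝ := fun α => (1 / 2 : ℝ) ^ Encodable.encode α
  have hεs : Summable ε := summable_geometric_two_encode
  have hε0 : ∀ α, 0 < ε α := fun α => by positivity
  choose s hs1 hs using fun α => exists_scale_bound (hψ α) (hψc α) α.degree (hε0 α)
  -- by homogeneity, `F α` is the monomial `mon α` times the cut-off function `x ↦ χ (s α • x)`
  let F : (Fin n →₀ ℕ) → E n → ℝ := fun α x =>
    (s α ^ α.degree)⁻¹ * (mon α (s α • x) * χ (s α • x))
  have hFs : ∀ α, ContDiff ℝ ∞ (F α) := fun α =>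
    contDiff_const.mul ((hψ α).comp (contDiff_const_smul (s α)))
  have hFb : ∀ α, ∀ k < α.degree, ∀ x, ‖iteratedFDeriv ℝ k (F α) x‖ ≤ ε α := hs
  have hF0 : ∀ α, F α =ᶠ[𝓝 0] mon α := by
    intro α
    have hs0 : 0 < s α := by linarith [hs1 α]
    have hcont : Filter.Tendsto (fun x : E n => s α • x) (𝓝 0) (𝓝 0) := by
      have : Continuous fun x : E n => s α • x := continuous_const_smul _
      simpa using this.tendsto 0
    filter_upwards [hcont (Metric.closedBall_mem_nhds (0 : E n) one_pos)] with x hx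
    have h1 : χ (s α • x) = 1 := χ.one_of_mem_closedBall hx
    simp only [F]
    rw [h1, hmonhom, mul_one, inv_mul_cancel_left₀ (by positivity)]
  have hjF : ∀ α, jet (F α) = MvPowerSeries.monomial α (MvPowerSeries.coeff α a) := by
    intro α
    rw [jet_congr (hF0 α), (jet_eval (u := fun x : E n => fun i => x i)
      (fun j => (contDiff_coord j).contDiffAt) _).2]
    simp only [jet_coord, aeval_X_eq_coe]
    exact MvPolynomial.coe_monomial _ _
  have hfin : ∀ k : ℕ, ∀ᶠ α : Fin n →₀ ℕ in Filter.cofinite, k < α.degree := by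
    intro k
    have := Finsupp.finite_of_degree_le (σ := Fin n) k
    filter_upwards [this.compl_mem_cofinite] with α hα
    simpa using hα
  have hf : ContDiff ℝ ∞ fun x => ∑' α, F α x :=
    contDiff_tsum_of_eventually (N := ⊤) (v := fun _ => ε) hFs (fun _ _ => hεs) fun k _ => by
      filter_upwards [hfin k] with α hα x using hFb α k hα x
  have hsum : ∀ x, Summable fun α => F α x := fun x =>
    hεs.of_norm_bounded_eventually (by
      filter_upwards [hfin 0] with α hα
      simpa using hFb α 0 hα x)
  refine ⟨_, hf, ?_⟩
  rw [← sub_eq_zero]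
  refine eq_zero_of_forall_mem_ordIdeal fun K => ?_
  -- split off the finitely many terms of degree less than `K`; the rest is flat to order `K`
  let T : Finset (Fin n →₀ ℕ) := (Finsupp.finite_of_degree_lt (σ := Fin n) K).toFinset
  have hT : ∀ α, α ∈ T ↔ α.degree < K := fun α => by simp [T]
  have hTn : ∀ α : {α // α ∉ T}, K ≤ α.1.degree := fun α => by
    have := α.2
    rw [hT] at this
    omega
  have hsplit : (fun x => ∑' α, F α x) =
      fun x => ∑ α ∈ T, F α x + ∑' α : {α // α ∉ T}, F α.1 x := by
    funext x
    exact ((hsum x).sum_add_tsum_subtype_compl T).symm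
  have hhead : ContDiff ℝ ∞ fun x => ∑ α ∈ T, F α x := ContDiff.sum fun α _ => hFs α
  have htail : ContDiff ℝ ∞ fun x => ∑' α : {α // α ∉ T}, F α.1 x := by
    have : (fun x => ∑' α : {α // α ∉ T}, F α.1 x) =
        fun x => (∑' α, F α x) - ∑ α ∈ T, F α x := by
      funext x
      rw [← (hsum x).sum_add_tsum_subtype_compl T, add_sub_cancel_left]
    rw [this]
    exact hf.sub hhead
  have htailjet : jet (fun x => ∑' α : {α // α ∉ T}, F α.1 x) ∈ ordIdeal n K := by
    refine jet_mem_of_iteratedFDeriv_eq_zero htail.contDiffAt fun i hi => ?_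
    have hεT : Summable fun α : {α // α ∉ T} => ε α.1 :=
      hεs.comp_injective Subtype.val_injective
    refine iteratedFDeriv_tsum_eq_zero (fun α => hFs α.1) hεT
      (fun k hk α x => hFb α.1 k (by have := hTn α; omega) x) fun α => ?_
    refine iteratedFDeriv_eq_zero_of_jet_mem (hFs α.1).contDiffAt ?_
    rw [hjF]
    intro β hβ
    rw [MvPowerSeries.coeff_monomial, if_neg]
    rintro rfl
    have := hTn α
    omega
  rw [hsplit, jet_add hhead.contDiffAt htail.contDiffAt,
    jet_sum _ fun α _ => (hFs α).contDiffAt, add_sub_right_comm]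
  refine add_mem (fun β hβ => ?_) htailjet
  rw [map_sub, map_sum, Finset.sum_eq_single β, hjF, MvPowerSeries.coeff_monomial, if_pos rfl,
    sub_self]
  · intro α _ hαβ
    rw [hjF, MvPowerSeries.coeff_monomial, if_neg (Ne.symm hαβ)]
  · intro h
    exact absurd ((hT β).2 hβ) h

/-! ### The formal normal form -/

/-- A completely integrable formal vector field `D` with non-nilpotent linear part is, in suitable
formal coordinates `y`, the product `g · L` of a linear vector field and a formal power series `g`
of the form `H(p(y))`, where the `p` are polynomial first integrals of `L`. The composition
`H(p(y))` is expressed through polynomials `Q` that agree with `H` up to a given order. -/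
theorem exists_formal_normal_form {D : Derivation ℝ (PS n) (PS n)}
    (hD : ∀ k, ∀ a ∈ ordIdeal n k, D a ∈ ordIdeal n k) (hlin : ¬ IsNilpotent (linCoeff D))
    {F : Fin (n - 1) → PS n} (hF : FormallyIndependent F) (hDF : ∀ i, D (F i) = 0) :
    ∃ (L : Matrix (Fin n) (Fin n) ℝ) (y : Fin n → PS n) (g : PS n) (m : ℕ)
      (p : Fin m → MvPolynomial (Fin n) ℝ) (H : PS m),
      (∀ i, y i - MvPowerSeries.X i ∈ ordIdeal n 2) ∧
      (∀ i, D (y i) = g * ∑ j, L i j • y j) ∧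
      MvPowerSeries.constantCoeff g = 1 ∧
      (∀ j, MvPolynomial.constantCoeff (p j) = 0) ∧ (∀ j, linDer L (p j) = 0) ∧
      ∀ K, ∃ Q : MvPolynomial (Fin m) ℝ, H - (Q : PS m) ∈ ordIdeal m K ∧
        g - MvPolynomial.aeval y (MvPolynomial.aeval p Q) ∈ ordIdeal n K := by
  obtain ⟨S, hS, hc, hss, hnil⟩ := exists_semisimple_derivation D hD
  have hSF : ∀ i, S (F i) = 0 := fun i => semisimple_eq_zero_of_eq_zero hS hc hss hnil (hDF i)
  obtain ⟨y, hy, hSy⟩ := exists_linearizing_coordinates hS hss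
  have hL0 := linCoeff_ne_zero hD hS hnil hlin
  obtain ⟨q, hq, hqL⟩ := exists_squarefree_aeval_linCoeff hS hss
  have hprop₀ := mul_comm_of_annihilated hF
    (d := fun j => D (MvPowerSeries.X j)) (s := fun j => S (MvPowerSeries.X j))
    (fun i => by rw [← derivation_eq_sum_pderiv D hD, hDF])
    (fun i => by rw [← derivation_eq_sum_pderiv S hS, hSF])
  have hprop : ∀ u v, D u * S v = D v * S u := by
    intro u v
    rw [derivation_eq_sum_pderiv D hD u, derivation_eq_sum_pderiv S hS v,
      derivation_eq_sum_pderiv D hD v, derivation_eq_sum_pderiv S hS u, Finset.sum_mul_sum,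
      Finset.sum_mul_sum, Finset.sum_comm]
    refine Finset.sum_congr rfl fun j _ => Finset.sum_congr rfl fun i _ => ?_
    linear_combination
      (MvPowerSeries.pderiv ℝ i u * MvPowerSeries.pderiv ℝ j v) * hprop₀ i j
  obtain ⟨g, hg⟩ := exists_ratio hD hS hc hL0 hq hqL hy hSy hprop
  have hne : ∃ i, S (y i) ≠ 0 := by
    by_contra! h
    refine hL0 (Matrix.ext fun i j => ?_)
    have h1 := sum_smul_coordinates_sub_mem hy (linCoeff S i)
    rw [← hSy, h, zero_sub] at h1
    exact eq_zero_of_sum_smul_X_mem (by simpa using neg_mem h1) j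
  have hSg := apply_ratio_eq_zero hc hSy hg hne
  obtain ⟨P, hP, hPL, hPg⟩ := exists_invariant_expansion hS hy hSy hSg
  obtain ⟨m, p, M, hp0, hpL, hQ⟩ := exists_invariant_generators (exists_linDer_eq hss hy hSy)
  choose Q hQP hQM using fun d => hQ d (P d) (hP d) (hPL d)
  -- the coefficient of `H` at `β` is a finite sum, as the terms of `Q d` have degree at
  -- least `d / M`
  let H : PS m := fun β => ∑ d ∈ Finset.range (M * β.degree + 1), (Q d).coeff β
  have hH : ∀ β, MvPowerSeries.coeff β H =
      ∑ d ∈ Finset.range (M * β.degree + 1), (Q d).coeff β := fun _ => rfl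
  refine ⟨linCoeff S, y, g, m, p, H, hy, fun i => by rw [hg, hSy],
    constantCoeff_ratio hD hS hnil hL0 hq hqL hy hg, hp0, hpL,
    fun K => ⟨∑ d ∈ Finset.range ((M + 1) * K), Q d, fun β hβ => ?_, ?_⟩⟩
  · rw [map_sub, hH, MvPolynomial.coeff_coe, MvPolynomial.coeff_sum, sub_eq_zero]
    have h1 : M * β.degree ≤ M * K := Nat.mul_le_mul_left M hβ.le
    refine Finset.sum_subset (fun d hd => ?_) fun d _ hd => ?_
    · rw [Finset.mem_range] at hd ⊢
      rw [add_mul, one_mul]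
      omega
    · by_contra hne
      have := hQM d β hne
      rw [Finset.mem_range] at hd
      omega
  · simp only [map_sum, hQP]
    refine ordIdeal_anti ?_ (hPg ((M + 1) * K))
    exact Nat.le_mul_of_pos_left K (Nat.succ_pos M)

/-! ### Realization by smooth coordinates -/

theorem contDiff_eval (P : MvPolynomial (Fin n) ℝ) :
    ContDiff ℝ ∞ fun x : E n => MvPolynomial.eval (fun i => x i) P := by
  induction P using MvPolynomial.induction_on with
  | C a => simpa using contDiff_const
  | add p q hp hq => simpa using hp.add hq
  | mul_X p j hp => simpa using hp.mul (contDiff_coord j)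

theorem partialDeriv_eval (i : Fin n) (P : MvPolynomial (Fin n) ℝ) (x : E n) :
    partialDeriv i (fun x : E n => MvPolynomial.eval (fun i => x i) P) x =
      MvPolynomial.eval (fun i => x i) (MvPolynomial.pderiv i P) := by
  induction P using MvPolynomial.induction_on with
  | C a =>
    simp only [MvPolynomial.eval_C, MvPolynomial.pderiv_C, map_zero]
    rw [partialDeriv_const]
  | add p q hp hq =>
    simp only [map_add]
    rw [(partialDeriv_add (contDiff_eval p).contDiffAt (contDiff_eval q).contDiffAt i).eq_of_nhds,
      hp, hq]
  | mul_X p j hp =>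
    have hX : partialDeriv i (fun x : E n => x j) x =
        MvPolynomial.eval (fun i => x i) (MvPolynomial.pderiv i (MvPolynomial.X j)) := by
      have : HasFDerivAt (fun x : E n => x j) (EuclideanSpace.proj (𝕜 := ℝ) j) x :=
        (EuclideanSpace.proj (𝕜 := ℝ) j).hasFDerivAt
      simp only [partialDeriv]
      rw [this.fderiv, MvPolynomial.pderiv_X]
      by_cases h : i = j
      · subst h; simp
      · simp [h]
    simp only [map_mul, MvPolynomial.eval_X]
    rw [(partialDeriv_mul (contDiff_eval p).contDiffAt (contDiff_coord j).contDiffAt i).eq_of_nhds,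
      hp, hX, Derivation.leibniz]
    simp

/-- A smooth function of polynomial first integrals of a linear vector field is a first integral of
this vector field. -/
theorem fderiv_comp_invariants {L : Matrix (Fin n) (Fin n) ℝ} {m : ℕ}
    {p : Fin m → MvPolynomial (Fin n) ℝ} (hp : ∀ j, linDer L (p j) = 0) {h : E m → ℝ}
    (hh : ContDiff ℝ ∞ h) (x : E n) :
    fderiv ℝ (fun x : E n => h (WithLp.toLp 2 fun j => MvPolynomial.eval (fun i => x i) (p j))) x
      (Matrix.toEuclideanCLM (𝕜 := ℝ) L x) = 0 := by
  let P : E n → E m := fun x => WithLp.toLp 2 fun j => MvPolynomial.eval (fun i => x i) (p j)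
  have hPs : ContDiff ℝ ∞ P := (contDiff_euclidean).2 fun j => contDiff_eval (p j)
  have d1 : DifferentiableAt ℝ h (P x) := hh.contDiffAt.differentiableAt (by simp)
  have d2 : DifferentiableAt ℝ P x := hPs.contDiffAt.differentiableAt (by simp)
  have e1 : fderiv ℝ (fun x => h (P x)) x = (fderiv ℝ h (P x)).comp (fderiv ℝ P x) :=
    fderiv_comp x d1 d2
  change fderiv ℝ (fun x => h (P x)) x _ = 0
  have e2 : fderiv ℝ P x (Matrix.toEuclideanCLM (𝕜 := ℝ) L x) = 0 := by
    ext j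
    have e3 : fderiv ℝ (fun x => P x j) x =
        (EuclideanSpace.proj (𝕜 := ℝ) j).comp (fderiv ℝ P x) :=
      ((EuclideanSpace.proj (𝕜 := ℝ) j).hasFDerivAt.comp x d2.hasFDerivAt).fderiv
    have e4 : fderiv ℝ P x (Matrix.toEuclideanCLM (𝕜 := ℝ) L x) j =
        fderiv ℝ (fun x => P x j) x (Matrix.toEuclideanCLM (𝕜 := ℝ) L x) := by
      rw [e3]; rfl
    rw [e4, fderiv_apply_eq_sum]
    have e5 := congrArg (MvPolynomial.eval fun i => x i) (hp j)
    rw [linDer_apply, map_sum, map_zero] at e5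
    rw [PiLp.zero_apply, ← e5]
    refine Finset.sum_congr rfl fun i _ => ?_
    have e6 : partialDeriv i (fun x => P x j) x =
      MvPolynomial.eval (fun i => x i) (MvPolynomial.pderiv i (p j)) := partialDeriv_eval i (p j) x
    rw [e6, map_mul, mul_comm, map_sum]
    congr 1
    rw [Matrix.ofLp_toEuclideanCLM]
    simp [Matrix.mulVec, dotProduct, MvPolynomial.smul_eval]
  rw [e1, ContinuousLinearMap.comp_apply, e2, map_zero]

/-- A smooth map tangent to the identity at the origin is a coordinate system on a neighbourhood of
the origin contained in a given open set. -/
theorem exists_smoothCoordinates {U : Set (E n)} (hU : IsOpen U) (hO : (0 : E n) ∈ U)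
    {Y : E n → E n} (hY : ContDiff ℝ ∞ Y) (hY0 : Y 0 = 0)
    (hY1 : fderiv ℝ Y 0 = ContinuousLinearMap.id ℝ (E n)) :
    ∃ φ : OpenPartialHomeomorph (E n) (E n), IsSmoothCoordinates U φ ∧ (φ : E n → E n) = Y := by
  have hd : ∀ x, HasFDerivAt Y (fderiv ℝ Y x) x := fun x =>
    (hY.contDiffAt.differentiableAt (by simp)).hasFDerivAt
  have hd0 : HasFDerivAt Y ((ContinuousLinearEquiv.refl ℝ (E n) : E n ≃L[ℝ] E n) :
      E n →L[ℝ] E n) 0 := by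
    have := hd 0
    rw [hY1] at this
    exact this
  let φ₀ := ContDiffAt.toOpenPartialHomeomorph (n := ∞) Y hY.contDiffAt hd0 (by simp)
  have hφ₀ : (φ₀ : E n → E n) = Y := rfl
  have h0 : (0 : E n) ∈ φ₀.source := hY.contDiffAt.mem_toOpenPartialHomeomorph_source hd0 (by simp)
  let V : Set (E n) := U ∩ {x | IsUnit (fderiv ℝ Y x)}
  have hV : IsOpen V := by
    refine hU.inter ?_
    exact Units.isOpen.preimage (hY.continuous_fderiv (by simp))
  let φ := φ₀.restrOpen V hV
  have hφ : (φ : E n → E n) = Y := rfl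
  have hsource : φ.source = φ₀.source ∩ V := rfl
  refine ⟨φ, ⟨?_, ?_, ?_, ?_, ?_⟩, hφ⟩
  · rw [hsource]
    refine ⟨h0, hO, ?_⟩
    change IsUnit (fderiv ℝ Y 0)
    rw [hY1]
    exact isUnit_one
  · rw [hsource]
    exact fun x hx => hx.2.1
  · rw [hφ, hY0]
  · rw [hφ]
    exact hY.contDiffOn
  · intro y hy
    have hy' := φ.map_target hy
    rw [hsource] at hy'
    obtain ⟨u, hu⟩ := hy'.2.2
    refine (φ.contDiffAt_symm (f₀' := ContinuousLinearEquiv.unitsEquiv ℝ (E n) u) hy ?_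
      hY.contDiffAt).contDiffWithinAt
    have := hd (φ.symm y)
    rw [← hu] at this
    exact this

theorem fderiv_apply_coord {Y : E n → E n} {x : E n} (hY : DifferentiableAt ℝ Y x) (v : E n)
    (i : Fin n) : fderiv ℝ Y x v i = fderiv ℝ (fun x => Y x i) x v := by
  have e : fderiv ℝ (fun x => Y x i) x =
      (EuclideanSpace.proj (𝕜 := ℝ) i).comp (fderiv ℝ Y x) :=
    ((EuclideanSpace.proj (𝕜 := ℝ) i).hasFDerivAt.comp x hY.hasFDerivAt).fderiv
  rw [e]
  rfl

theorem fderiv_eq_zero_of_isFlat {R : E n → E n} (hR : IsFlat R) : fderiv ℝ R 0 = 0 := by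
  ext1 v
  have := congrArg (fun T => T fun _ => v) (hR 1)
  simpa [iteratedFDeriv_one_apply] using this

/-- The derivation of the ring of formal power series given by the jet of a vector field. -/
noncomputable def jetDerivation (X : E n → E n) : Derivation ℝ (PS n) (PS n) :=
  ∑ j, jet (fun x => X x j) • MvPowerSeries.pderiv ℝ j

theorem jetDerivation_apply (X : E n → E n) (a : PS n) :
    jetDerivation X a = ∑ j, jet (fun x => X x j) * MvPowerSeries.pderiv ℝ j a := by
  change Derivation.coeFnAddMonoidHom (∑ j, jet (fun x => X x j) • MvPowerSeries.pderiv ℝ j) a = _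
  rw [map_sum, Finset.sum_apply]
  rfl

theorem jetDerivation_mem {X : E n → E n} (hX0 : X 0 = 0) (k : ℕ) (a : PS n)
    (ha : a ∈ ordIdeal n k) : jetDerivation X a ∈ ordIdeal n k := by
  rw [jetDerivation_apply]
  refine Submodule.sum_mem _ fun j _ => ?_
  cases k with
  | zero => exact mem_ordIdeal_zero _
  | succ k =>
    have h1 : jet (fun x => X x j) ∈ ordIdeal n 1 := by
      rw [mem_ordIdeal_one, constantCoeff_jet, hX0, PiLp.zero_apply]
    have := mul_mem_ordIdeal h1 (pderiv_mem_ordIdeal j ha)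
    rwa [add_comm] at this

theorem linCoeff_jetDerivation {X : E n → E n} (hX : ContDiffAt ℝ ∞ X 0) :
    Matrix.toEuclideanCLM (𝕜 := ℝ) (linCoeff (jetDerivation X)) = linearPart X := by
  have hXj : ∀ j, ContDiffAt ℝ ∞ (fun x => X x j) 0 := fun j =>
    (contDiff_coord j).contDiffAt.comp 0 hX
  have h1 : ∀ i, jetDerivation X (MvPowerSeries.X i) = jet (fun x => X x i) := by
    intro i
    rw [jetDerivation_apply, Finset.sum_eq_single i]
    · simp
    · intro j _ hj
      rw [MvPowerSeries.pderiv_X_of_ne (Ne.symm hj), mul_zero]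
    · simp
  ext v i
  rw [Matrix.ofLp_toEuclideanCLM, linearPart, fderiv_apply_coord (hX.differentiableAt (by simp)),
    fderiv_apply_eq_sum]
  change ∑ j, linCoeff (jetDerivation X) i j * v j = _
  refine Finset.sum_congr rfl fun j _ => ?_
  rw [linCoeff, h1, coeff_single_jet (hXj i), mul_comm]

/-- If the linear part has a nonzero semisimple part, then it is not nilpotent. -/
theorem not_isNilpotent_linCoeff {X : E n → E n} (hX : ContDiffAt ℝ ∞ X 0)
    (hss : semisimplePart (linearPart X : Module.End ℝ (E n)) ≠ 0) :
    ¬ IsNilpotent (linCoeff (jetDerivation X)) := by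
  intro h
  have h1 : IsNilpotent (linearPart X) := by
    rw [← linCoeff_jetDerivation hX]
    exact h.map (Matrix.toEuclideanCLM (𝕜 := ℝ) (n := Fin n))
  have h2 : IsNilpotent (linearPart X : Module.End ℝ (E n)) :=
    h1.map (ContinuousLinearMap.toLinearMapRingHom (R₁ := ℝ) (M₁ := E n))
  obtain ⟨hS, hN, hc⟩ := Classical.choose_spec
    (exists_semisimplePart (linearPart X : Module.End ℝ (E n)))
  refine hss (Module.End.eq_zero_of_isNilpotent_isSemisimple ?_ hS)
  have h3 := (Commute.sub_right (Commute.refl _) hc).isNilpotent_sub h2 hN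
  rwa [sub_sub_cancel] at h3

end SmoothIntegrable

open SmoothIntegrable Topology in
theorem proposition2p3 {n : ℕ} (U : Set (SmoothIntegrable.E n)) (hU : IsOpen U)
    (hO : (0 : SmoothIntegrable.E n) ∈ U)
    (X : SmoothIntegrable.E n → SmoothIntegrable.E n)
    (hX : ContDiffOn ℝ ∞ X U) (hX0 : X 0 = 0)
    -- complete integrability
    (F : Fin (n - 1) → SmoothIntegrable.E n → ℝ)
    (hF : ∀ i, ContDiffOn ℝ ∞ (F i) U)
    (hFX : ∀ i, SmoothIntegrable.IsFirstIntegral U X (F i))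
    (hFind : ∀ᵐ x ∂(volume.restrict U), LinearIndependent ℝ (fun i => fderiv ℝ (F i) x))
    -- first nondegeneracy condition
    (hss : SmoothIntegrable.semisimplePart
      (SmoothIntegrable.linearPart X : Module.End ℝ (SmoothIntegrable.E n)) ≠ 0)
    (hjet : SmoothIntegrable.FormallyIndependent (fun i => SmoothIntegrable.jet (F i)))
    -- second nondegeneracy condition; `k` is the multiplicity of the eigenvalue `0`
    (hzero : ∀ k : ℕ, 1 ≤ k →
      (LinearMap.charpoly (SmoothIntegrable.linearPart X :
        Module.End ℝ (SmoothIntegrable.E n))).rootMultiplicity 0 = k →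
      LinearIndependent ℝ (fun i : {i : Fin (n - 1) // (i : ℕ) < k} => fderiv ℝ (F i) 0)) :
    ∃ φ : OpenPartialHomeomorph (SmoothIntegrable.E n) (SmoothIntegrable.E n),
      SmoothIntegrable.IsSmoothCoordinates U φ ∧
      ∃ (f : SmoothIntegrable.E n → ℝ) (R : SmoothIntegrable.E n → SmoothIntegrable.E n),
        ContDiffOn ℝ ∞ f φ.target ∧
        SmoothIntegrable.IsFirstIntegral φ.target
          (SmoothIntegrable.linearPart (SmoothIntegrable.inCoordinates φ X)) f ∧
        ContDiffOn ℝ ∞ R φ.target ∧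
        SmoothIntegrable.IsFlat R ∧
        ∀ y ∈ φ.target, SmoothIntegrable.inCoordinates φ X y =
          f y • SmoothIntegrable.linearPart (SmoothIntegrable.inCoordinates φ X) y + R y := by
  have hU0 : U ∈ 𝓝 (0 : E n) := hU.mem_nhds hO
  have hXat : ContDiffAt ℝ ∞ X 0 := hX.contDiffAt hU0
  have hFat : ∀ i, ContDiffAt ℝ ∞ (F i) 0 := fun i => (hF i).contDiffAt hU0
  have hDjet : ∀ {f : E n → ℝ}, ContDiffAt ℝ ∞ f 0 →
      jetDerivation X (jet f) = jet fun x => fderiv ℝ f x (X x) := fun hf => by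
    rw [jetDerivation_apply, jet_fderiv_apply hf hXat]
  have hDF : ∀ i, jetDerivation X (jet (F i)) = 0 := by
    intro i
    rw [hDjet (hFat i), ← jet_zero (n := n)]
    refine jet_congr ?_
    filter_upwards [hU0] with x hx using hFX i x hx
  obtain ⟨L, y, g, m, p, H, hy, hDy, hg1, hp0, hpL, hQ⟩ := exists_formal_normal_form
    (jetDerivation_mem hX0) (not_isNilpotent_linCoeff hXat hss) hjet hDF
  -- smooth coordinates with jets `y`, and a smooth function with jet `H`
  choose Yc hYc hYjet using fun i => exists_contDiff_jet_eq (y i)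
  obtain ⟨h, hh, hhjet⟩ := exists_contDiff_jet_eq H
  let Y : E n → E n := fun x => WithLp.toLp 2 fun i => Yc i x
  have hYi : ∀ i, (fun x => Y x i) = Yc i := fun _ => rfl
  have hY : ContDiff ℝ ∞ Y := contDiff_euclidean.2 hYc
  have hyI : ∀ i, y i ∈ ordIdeal n 1 := fun i => by
    have := add_mem (ordIdeal_anti (by omega) (hy i)) (X_mem_ordIdeal i)
    rwa [sub_add_cancel] at this
  have hY0 : Y 0 = 0 := by
    ext i
    have := mem_ordIdeal_one.1 (hyI i)
    rw [← hYjet, constantCoeff_jet] at this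
    exact this
  have hY1 : fderiv ℝ Y 0 = ContinuousLinearMap.id ℝ (E n) := by
    ext v i
    rw [fderiv_apply_coord (hY.contDiffAt.differentiableAt (by simp)), hYi, fderiv_apply_eq_sum]
    have hpart : ∀ j, partialDeriv j (Yc i) 0 = if j = i then 1 else 0 := by
      intro j
      have h1 : MvPowerSeries.coeff (Finsupp.single j 1) (y i - MvPowerSeries.X i) = 0 :=
        hy i _ (by simp)
      rw [map_sub, sub_eq_zero, ← hYjet, coeff_single_jet (hYc i).contDiffAt] at h1
      rw [h1, MvPowerSeries.coeff_X]
      simp [Finsupp.single_left_inj]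
    simp [hpart]
  obtain ⟨φ, hφ, hφY⟩ := exists_smoothCoordinates hU hO hY hY0 hY1
  let pm : E n → E m := fun x => WithLp.toLp 2 fun j => MvPolynomial.eval (fun i => x i) (p j)
  have hpm : ContDiff ℝ ∞ pm := contDiff_euclidean.2 fun j => contDiff_eval (p j)
  have hpm0 : pm 0 = 0 := by
    ext j
    have h1 : MvPolynomial.eval (fun _ => (0 : ℝ)) (p j) = MvPolynomial.constantCoeff (p j) :=
      congrArg (fun e => e (p j)) MvPolynomial.eval_zero'
    rw [hp0] at h1
    exact h1
  let G : E n → ℝ := fun x => h (pm x)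
  have hG : ContDiff ℝ ∞ G := hh.comp hpm
  have hGY : ContDiff ℝ ∞ fun x => G (Y x) := hG.comp hY
  have hGjet : jet (fun x => G (Y x)) = g := by
    rw [← sub_eq_zero]
    refine eq_zero_of_forall_mem_ordIdeal fun K => ?_
    obtain ⟨Q, hQH, hQg⟩ := hQ K
    have hQs := contDiff_eval Q
    have hcoe : jet (fun u : E m => MvPolynomial.eval (fun i => u i) Q) = (Q : PS m) := by
      rw [(jet_eval (u := fun u : E m => fun i => u i)
        (fun j => (contDiff_coord j).contDiffAt) Q).2]
      simp only [jet_coord, aeval_X_eq_coe]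
    have h1 : jet (fun u => h u - MvPolynomial.eval (fun i => u i) Q) ∈ ordIdeal m K := by
      rw [jet_sub hh.contDiffAt hQs.contDiffAt, hhjet, hcoe]
      exact hQH
    have h2 := jet_comp_mem (p := fun x => pm (Y x)) (hh.sub hQs).contDiffAt
      (hpm.comp hY).contDiffAt (by rw [hY0, hpm0]) h1
    have hpY : ∀ j, ContDiffAt ℝ ∞ (fun x => pm (Y x) j) 0 ∧
        jet (fun x => pm (Y x) j) = MvPolynomial.aeval y (p j) := by
      intro j
      have := jet_eval (u := fun x i => Yc i x) (fun i => (hYc i).contDiffAt) (p j)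
      refine ⟨this.1, this.2.trans ?_⟩
      simp only [hYjet]
    have h3 := jet_eval (u := fun x j => pm (Y x) j) (fun j => (hpY j).1) Q
    have h4 : MvPolynomial.aeval (fun j => jet fun x => pm (Y x) j) Q =
        MvPolynomial.aeval y (MvPolynomial.aeval p Q) := by
      have e : (fun j => jet fun x => pm (Y x) j) = fun j => MvPolynomial.aeval y (p j) :=
        funext fun j => (hpY j).2
      rw [e]
      exact (MvPolynomial.comp_aeval_apply p (MvPolynomial.aeval y) Q).symm
    rw [jet_sub hGY.contDiffAt h3.1, h3.2, h4] at h2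
    have h5 := sub_mem h2 hQg
    rwa [sub_sub_sub_cancel_right] at h5
  have hG0 : G 0 = 1 := by
    have := constantCoeff_jet (fun x => G (Y x))
    rw [hGjet, hg1, hY0] at this
    exact this.symm
  let Λ : E n →L[ℝ] E n := Matrix.toEuclideanCLM (𝕜 := ℝ) L
  have hΛ : ∀ v i, Λ v i = ∑ j, L i j * v j := fun v i => by
    simp only [Λ, Matrix.ofLp_toEuclideanCLM]
    rfl
  let X' : E n → E n := inCoordinates φ X
  have hX' : ContDiffOn ℝ ∞ X' φ.target := by
    have h1 : ContDiffOn ℝ ∞ (fun z => fderiv ℝ φ (φ.symm z)) φ.target := by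
      rw [hφY]
      exact (hY.fderiv_right (m := ∞) (by simp)).comp_contDiffOn hφ.smooth_symm
    exact h1.clm_apply (hX.comp hφ.smooth_symm fun z hz => hφ.source_subset (φ.map_target hz))
  let R : E n → E n := fun z => X' z - G z • Λ z
  have hR : ContDiffOn ℝ ∞ R φ.target :=
    hX'.sub (hG.contDiffOn.smul Λ.contDiff.contDiffOn)
  have h0t : (0 : E n) ∈ φ.target := by
    rw [← hφ.map_zero]
    exact φ.map_source hφ.zero_mem
  have hsymm0 : φ.symm 0 = 0 := by
    conv_lhs => rw [← hφ.map_zero]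
    exact φ.left_inv hφ.zero_mem
  have ht0 : φ.target ∈ 𝓝 (0 : E n) := φ.open_target.mem_nhds h0t
  have hs0 : φ.source ∈ 𝓝 (0 : E n) := φ.open_source.mem_nhds hφ.zero_mem
  have hsymm : ContDiffAt ℝ ∞ φ.symm 0 := hφ.smooth_symm.contDiffAt ht0
  have hRi : ∀ i, ContDiffAt ℝ ∞ (fun z => R z i) 0 := fun i =>
    (contDiff_coord i).contDiffAt.comp 0 (hR.contDiffAt ht0)
  -- in the original coordinates the remainder has the jet `D y - g L y`
  have hRY : ∀ i, jet (fun x => R (Y x) i) = 0 := by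
    intro i
    have hXY : ContDiffAt ℝ ∞ (fun x => fderiv ℝ (Yc i) x (X x)) 0 :=
      (((hYc i).fderiv_right (m := ∞) (by simp)).contDiffAt).clm_apply hXat
    have hsum : ContDiff ℝ ∞ fun x => ∑ j, L i j * Yc j x :=
      ContDiff.sum fun j _ => contDiff_const.mul (hYc j)
    have e : (fun x => R (Y x) i) =ᶠ[𝓝 0]
        fun x => fderiv ℝ (Yc i) x (X x) - G (Y x) * ∑ j, L i j * Yc j x := by
      filter_upwards [hs0] with x hx
      have hinv : φ.symm (Y x) = x := by
        rw [← hφY]; exact φ.left_inv hx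
      have e1 : X' (Y x) i = fderiv ℝ (Yc i) x (X x) := by
        change fderiv ℝ φ (φ.symm (Y x)) (X (φ.symm (Y x))) i = _
        rw [hinv, hφY, fderiv_apply_coord (hY.contDiffAt.differentiableAt (by simp)), hYi]
      change X' (Y x) i - G (Y x) * Λ (Y x) i = _
      rw [e1, hΛ]
    rw [jet_congr e, jet_sub hXY (hGY.mul hsum).contDiffAt, jet_mul hGY.contDiffAt hsum.contDiffAt,
      ← hDjet (hYc i).contDiffAt, hYjet, hGjet, hDy,
      jet_sum _ fun j _ => (contDiff_const.mul (hYc j)).contDiffAt, sub_eq_zero]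
    congr 1
    refine Finset.sum_congr rfl fun j _ => ?_
    rw [jet_mul contDiffAt_const (hYc j).contDiffAt, jet_const, hYjet, MvPowerSeries.smul_eq_C_mul]
  have hRflat : IsFlat R := by
    refine isFlat_of_jet_eq_zero hRi fun i => eq_zero_of_forall_mem_ordIdeal fun K => ?_
    have hRYs : ContDiffAt ℝ ∞ (fun x => R (Y x) i) 0 := by
      have h1 : ContDiffAt ℝ ∞ (fun z => R z i) (Y 0) := by
        rw [hY0]
        exact hRi i
      exact h1.comp 0 hY.contDiffAt
    have h1 := jet_comp_mem (k := K) hRYs hsymm hsymm0 (by rw [hRY]; exact zero_mem _)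
    have e : (fun z => R z i) =ᶠ[𝓝 0] fun z => R (Y (φ.symm z)) i := by
      filter_upwards [ht0] with z hz
      rw [← hφY, φ.right_inv hz]
    rwa [jet_congr e]
  have hlin : linearPart X' = Λ := by
    have e : X' = fun z => G z • Λ z + R z := by
      funext z
      simp only [R]
      abel
    have hGd : DifferentiableAt ℝ G 0 := hG.contDiffAt.differentiableAt (by simp)
    have hRd : DifferentiableAt ℝ R 0 := (hR.contDiffAt ht0).differentiableAt (by simp)
    have h1 : HasFDerivAt (fun z => G z • Λ z + R z)
        (G 0 • Λ + (fderiv ℝ G 0).smulRight (Λ 0) + fderiv ℝ R 0) 0 :=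
      (hGd.hasFDerivAt.smul Λ.hasFDerivAt).add hRd.hasFDerivAt
    rw [linearPart, e, h1.fderiv, hG0, fderiv_eq_zero_of_isFlat hRflat]
    ext v
    simp
  refine ⟨φ, hφ, G, R, hG.contDiffOn, ?_, hR, hRflat, fun z _ => ?_⟩
  · change IsFirstIntegral φ.target (linearPart X') G
    rw [hlin]
    exact fun z _ => fderiv_comp_invariants hpL hh z
  · change X' z = G z • linearPart X' z + R z
    rw [hlin]
    simp only [R]
    abel
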